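/- An \emph{ontology language} consists of a class $\mathcal A$ of axioms, a class $\mathcal C$ of consequences (both written as binary words), a class $\mathfrak O$ of finite subsets of $\mathcal A$, called ontologies, that is closed under subsets, and an entailment relation ${\models}\subseteq\mathfrak O\times\mathcal C$ that is monotone: $O\models c$ and $O\subseteq O'\in\mathfrak O$ imply $O'\models c$. A set $M\subseteq O$ is a \emph{justification} for $c$ with respect to the ontology $O$ if $M\models c$ and $M'\not\models c$ for all $M'\subsetneq M$. \emph{Entailment} is the problem of deciding, given an ontology $O$ and a consequence $c$, whether $O\models c$. \emph{AllJust} is the problem of deciding, given an ontology $O$, a consequence $c$ and a (possibly empty) set $\{M_1,\dots,M_n\}$ of sub-ontologies of $O$, whether $M_1,\dots,M_n$ are exactly all the justifications for $c$ with respect to $O$. Finite sets are given by repetition-free listings of their elements, a problem is in a class if some language of the class answers correctly on every code of every instance, and completeness refers to polynomial-time many-one reductions. Let $\mathsf C$ be a complexity class that is at least PSPACE in the sense that it absorbs polynomial space, $\mathrm{PSPACE}^{\mathsf C}\subseteq\mathsf C$ (where $\mathrm{PSPACE}^{\mathsf C}$ is the class of languages decided by a deterministic polynomial-space machine with an oracle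 from $\mathsf C$, the oracle queries being counted as occupied space). For every ontology language, if entailment is $\mathsf C$-complete, then AllJust is $\mathsf C$-complete as well. Moreover, the standard deterministic classes from PSPACE upwards satisfy this condition: $\mathrm{PSPACE}^{\mathsf C}\subseteq\mathsf C$ holds for $\mathsf C = k\text{-EXPSPACE}$ for every $k\ge 0$ (with $0$-EXPSPACE $=$ PSPACE) and for $\mathsf C = k\text{-EXPTIME}$ for every $k\ge 1$. -/

import Mathlib

/-! ### Deterministic oracle Turing machines

The machines are multi-stack machines over Mathlib's statement language `Turing.TM2.Stmt`
(a pair of stacks is a tape), with finitely many stacks of bits, finitely many labels and a finite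
internal state, together with the usual three distinguished oracle labels. -/

/-- A deterministic Turing machine with an oracle. -/
structure OracleTM where
  /-- the stacks -/
  K : Type
  [kDecidableEq : DecidableEq K]
  [kFintype : Fintype K]
  /-- the control labels -/
  Λ : Type
  [ΛFintype : Fintype Λ]
  /-- the internal states -/
  σ : Type
  [σFintype : Fintype σ]
  /-- the stack that holds the input -/
  input : K
  /-- the stack on which oracle queries are written -/
  queryStack : K
  /-- the label at which a computation starts -/
  main : Λ
  /-- the internal state in which a computation starts -/
  initialState : σ
  /-- the label at which the oracle is consulted -/
  query : Λ
  /-- the label entered after a positive answer -/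
  yes : Λ
  /-- the label entered after a negative answer -/
  no : Λ
  /-- the internal states in which a halted computation counts as accepting -/
  accept : σ → Bool
  /-- the program -/
  program : Λ → Turing.TM2.Stmt (fun _ : K => Bool) Λ σ

attribute [instance] OracleTM.kDecidableEq OracleTM.kFintype OracleTM.ΛFintype OracleTM.σFintype

namespace OracleTM

/-- Configurations: label (`none` once halted), internal state and contents of the stacks. -/
abbrev Cfg (M : OracleTM) : Type := Turing.TM2.Cfg (fun _ : M.K => Bool) M.Λ M.σ

/-- The initial configuration on the input `x`. -/
def init (M : OracleTM) (x : List Bool) : M.Cfg :=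
  ⟨some M.main, M.initialState, Function.update (fun _ => []) M.input x⟩

open Classical in
/-- One step with the oracle `A`. At the label `query` the word on the query stack is erased and the
control moves to `yes` or `no`, according to whether the word is in `A`; at every other label the
statement of that label is executed. -/
noncomputable def step (M : OracleTM) (A : Set (List Bool)) : M.Cfg → Option M.Cfg
  | ⟨none, _, _⟩ => none
  | ⟨some l, v, S⟩ =>
    if l = M.query then
      some ⟨some (if S M.queryStack ∈ A then M.yes else M.no), v,
        Function.update S M.queryStack []⟩
    else some (Turing.TM2.stepAux (M.program l) v S)

/-- The space occupied by a configuration: all symbols on all stacks, query stack included. -/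
def space (M : OracleTM) (c : M.Cfg) : ℕ := ∑ k, (c.stk k).length

/-- The halted configuration `c` gives the correct answer to "is `x` in `L`?". -/
def Answers (M : OracleTM) (L : Set (List Bool)) (x : List Bool) (c : M.Cfg) : Prop :=
  c.l = none ∧ (M.accept c.var = true ↔ x ∈ L)

/-- With the oracle `A`, the machine decides `L`, on inputs of length `n` within `t n` steps. -/
def DecidesInTime (M : OracleTM) (A L : Set (List Bool)) (t : ℕ → ℕ) : Prop :=
  ∀ x : List Bool, ∃ c : M.Cfg, M.Answers L x c ∧
    Nonempty (StateTransition.EvalsToInTime (M.step A) (M.init x) (some c) (t x.length))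

/-- With the oracle `A`, the machine decides `L` (in particular, it halts on every input) and, on
inputs of length `n`, no configuration of its computation occupies more than `s n` space. -/
def DecidesInSpace (M : OracleTM) (A L : Set (List Bool)) (s : ℕ → ℕ) : Prop :=
  ∀ x : List Bool,
    (∃ c : M.Cfg, M.Answers L x c ∧ StateTransition.Reaches (M.step A) (M.init x) c) ∧
    ∀ c : M.Cfg, StateTransition.Reaches (M.step A) (M.init x) c → M.space c ≤ s x.length

end OracleTM

/-! ### Complexity classes

A complexity class is a set of languages over the alphabet `Bool`. -/

/-- `PSPACE^C`: the languages decided in polynomial space with an oracle from the class `C`. -/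
def PSPACEWithOracle (C : Set (Set (List Bool))) : Set (Set (List Bool)) :=
  {L | ∃ A ∈ C, ∃ (M : OracleTM) (p : Polynomial ℕ), M.DecidesInSpace A L fun n => p.eval n}

/-- Iterated exponentials: `expTower 0 m = m` and `expTower (k + 1) m = 2 ^ expTower k m`. -/
def expTower : ℕ → ℕ → ℕ
  | 0, m => m
  | k + 1, m => 2 ^ expTower k m

/-- `k`-EXPSPACE (no oracle, that is, the empty one). `k = 0` is PSPACE, `k = 1` is EXPSPACE. -/
def EXPSPACE (k : ℕ) : Set (Set (List Bool)) :=
  {L | ∃ (M : OracleTM) (p : Polynomial ℕ),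
    M.DecidesInSpace ∅ L fun n => expTower k (p.eval n)}

/-- `k`-EXPTIME (no oracle, that is, the empty one). `k = 0` is P, `k = 1` is EXPTIME. -/
def EXPTIME (k : ℕ) : Set (Set (List Bool)) :=
  {L | ∃ (M : OracleTM) (p : Polynomial ℕ),
    M.DecidesInTime ∅ L fun n => expTower k (p.eval n)}

/-- `f` is computable in polynomial time by a Turing machine. -/
def PolyTimeComputable (f : List Bool → List Bool) : Prop :=
  Nonempty (Turing.TM2ComputableInPolyTime (αΓ := Bool) (βΓ := Bool)
    (fun w : List Bool => w) (fun w : List Bool => w) f)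

/-- A decision problem: its instances, the relation "the word `w` is a code of the instance `i`" (an
instance may have several codes, e.g. a finite set one for each listing), and the instances whose
answer is "yes". -/
structure DecisionProblem where
  /-- the instances -/
  Instance : Type*
  /-- which words are codes of which instances -/
  Codes : List Bool → Instance → Prop
  /-- the instances with answer "yes" -/
  Yes : Instance → Prop

namespace DecisionProblem

/-- The problem belongs to `C`: some language in `C` gives the correct answer on every code of every
instance. -/
def InClass (P : DecisionProblem) (C : Set (Set (List Bool))) : Prop :=
  ∃ L ∈ C, ∀ w i, P.Codes w i → (w ∈ L ↔ P.Yes i)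

/-- The problem is `C`-hard: every language in `C` has a polynomial-time many-one reduction to it. -/
def HardFor (P : DecisionProblem) (C : Set (Set (List Bool))) : Prop :=
  ∀ L ∈ C, ∃ f : List Bool → List Bool, PolyTimeComputable f ∧
    ∀ x, ∃ i, P.Codes (f x) i ∧ (x ∈ L ↔ P.Yes i)

/-- The problem is `C`-complete. -/
def CompleteFor (P : DecisionProblem) (C : Set (Set (List Bool))) : Prop :=
  P.InClass C ∧ P.HardFor C

end DecisionProblem

/-! ### Codes of finite sequences and finite sets -/

/-- Self-delimiting form of a word: every bit is preceded by `true`, and `false` marks the end. -/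
def delimit (w : List Bool) : List Bool := w.flatMap (fun b => [true, b]) ++ [false]

/-- The code of a finite sequence of words. -/
def seqCode (ws : List (List Bool)) : List Bool := ws.flatMap delimit

/-- `w` is a code of the finite set `S`: it codes a repetition-free listing of `S`, whose entries are
coded according to `R`. -/
def CodesFinset {α : Type*} (R : List Bool → α → Prop) (w : List Bool) (S : Finset α) : Prop :=
  ∃ (l : List α) (ws : List (List Bool)),
    l.Nodup ∧ (∀ a, a ∈ l ↔ a ∈ S) ∧ List.Forall₂ R ws l ∧ w = seqCode ws

/-! ### Ontology languages and justifications -/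

/-- An ontology language with axioms `𝒜` and consequences `𝒞`, both written as binary words. -/
structure OntologyLanguage (𝒜 𝒞 : Type*) where
  /-- the class of valid ontologies -/
  ontologies : Set (Finset 𝒜)
  /-- every subset of an ontology is an ontology -/
  subset_mem : ∀ O O' : Finset 𝒜, O ⊆ O' → O' ∈ ontologies → O ∈ ontologies
  /-- the entailment relation -/
  Entails : Finset 𝒜 → 𝒞 → Prop
  /-- entailment relates ontologies to consequences -/
  mem_of_entails : ∀ O c, Entails O c → O ∈ ontologies
  /-- entailment is monotonic -/
  mono : ∀ O O' c, O ∈ ontologies → O' ∈ ontologies → Entails O c → O ⊆ O' → Entails O' c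
  /-- how axioms are written -/
  axiomCode : Computability.Encoding 𝒜 Bool
  /-- how consequences are written -/
  consequenceCode : Computability.Encoding 𝒞 Bool

namespace OntologyLanguage

variable {𝒜 𝒞 : Type*}

/-- `M` is a justification for `c` with respect to `O`. -/
def IsJustification (𝓛 : OntologyLanguage 𝒜 𝒞) (O : Finset 𝒜) (c : 𝒞) (M : Finset 𝒜) : Prop :=
  M ⊆ O ∧ 𝓛.Entails M c ∧ ∀ M', M' ⊂ M → ¬ 𝓛.Entails M' c

/-- `w` is a code of the finite set `O` of axioms. -/
def CodesOntology (𝓛 : OntologyLanguage 𝒜 𝒞) (w : List Bool) (O : Finset 𝒜) : Prop :=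
  CodesFinset (fun v a => v = 𝓛.axiomCode.encode a) w O

/-- Instances of the entailment problem. -/
structure EntailmentInstance (𝓛 : OntologyLanguage 𝒜 𝒞) where
  /-- the ontology -/
  O : Finset 𝒜
  /-- the consequence -/
  c : 𝒞
  isOntology : O ∈ 𝓛.ontologies

/-- The problem of deciding, given an ontology `O` and a consequence `c`, whether `O` entails `c`. -/
def entailment (𝓛 : OntologyLanguage 𝒜 𝒞) : DecisionProblem where
  Instance := 𝓛.EntailmentInstance
  Codes w i := ∃ wO, 𝓛.CodesOntology wO i.O ∧ w = seqCode [wO, 𝓛.consequenceCode.encode i.c]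
  Yes i := 𝓛.Entails i.O i.c

/-- Instances of the problem `allJust`. -/
structure AllJustInstance (𝓛 : OntologyLanguage 𝒜 𝒞) where
  /-- the ontology -/
  O : Finset 𝒜
  /-- the consequence -/
  c : 𝒞
  /-- the finite set of sub-ontologies of `O` -/
  Ms : Finset (Finset 𝒜)
  isOntology : O ∈ 𝓛.ontologies
  subset : ∀ M ∈ Ms, M ⊆ O

/-- The problem of deciding, given an ontology `O`, a consequence `c` and a set `Ms` of
sub-ontologies of `O`, whether the members of `Ms` are all the justifications of `c` with respect to
`O`, that is, whether `Ms` is the set of these justifications. -/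
def allJust (𝓛 : OntologyLanguage 𝒜 𝒞) : DecisionProblem where
  Instance := 𝓛.AllJustInstance
  Codes w i := ∃ wMs wO, CodesFinset 𝓛.CodesOntology wMs i.Ms ∧ 𝓛.CodesOntology wO i.O ∧
    w = seqCode [wMs, wO, 𝓛.consequenceCode.encode i.c]
  Yes i := ∀ M, M ∈ i.Ms ↔ 𝓛.IsJustification i.O i.c M

end OntologyLanguage

/-! Membership. Entailing sub-ontologies of `O` form an up-set, and the justifications are its
minimal elements. Hence `Ms` is the set of all justifications iff `Ms` is an antichain and, for
every `N ⊆ O`, `N` entails `c` exactly when `N` contains a member of `Ms`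
(`forall_mem_iff_isJustification_iff`). Both conditions are read off one number, `countBelow`, the
number of listed sets contained in a given set: it must be 1 at each listed set, and positive
exactly at the entailing subsets. A polynomial-space machine with entailment as oracle checks this
by running through all subsets of `O` as bit vectors, so that `PSPACEWithOracle C ⊆ C` puts the
problem in `C`. The machine is written in a small structured language `Prog`, with a big-step
semantics `Exec` that keeps track of space; `Exec.run` compiles it to an `OracleTM`, and
`exec_testAllJust` is the correctness of the program.

Hardness. Every entailing set contains a minimal one, so the empty list is the complete list of
justifications iff `O` does not entail `c`. This reduces the complement of entailment to `allJust`,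
and `C` is closed under complement because a single oracle query can be negated in polynomial space.

The standard classes. An oracle machine `M` is composed with a machine `N` for its oracle (`comp`,
`comp_run`). Queries have polynomial length, so the space of `N` stays within the class. For time, a
halting computation of `M` never repeats a configuration and hence has at most exponentially many
steps; multiplying by the cost of a query adds exponents, which remains within `(k + 1)`-EXPTIME. -/

/-! ### Runs of deterministic systems -/

/-- `Run f P a b n`: the system `f` leads from `a` to `b` in `n` steps, and every state on the way
satisfies `P`. -/
inductive Run {α : Type*} (f : α → Option α) (P : α → Prop) : α → α → ℕ → Prop
  | refl {a : α} : P a → Run f P a a 0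
  | head {a b c : α} {n : ℕ} : P a → f a = some b → Run f P b c n → Run f P a c (n + 1)

namespace Run

variable {α : Type*} {f : α → Option α} {P Q : α → Prop} {a b c : α} {m n : ℕ}

theorem left (h : Run f P a b n) : P a := by
  cases h <;> assumption

theorem right (h : Run f P a b n) : P b := by
  induction h <;> assumption

theorem single (ha : P a) (h : f a = some b) (hb : P b) : Run f P a b 1 :=
  .head ha h (.refl hb)

theorem trans (h₁ : Run f P a b m) (h₂ : Run f P b c n) : Run f P a c (m + n) := by
  induction h₁ with
  | refl _ => simpa using h₂
  | head ha hf _ ih => rw [Nat.add_right_comm]; exact .head ha hf (ih h₂)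

theorem mono (h : Run f P a b n) (hPQ : ∀ x, P x → Q x) : Run f Q a b n := by
  induction h with
  | refl ha => exact .refl (hPQ _ ha)
  | head ha hf _ ih => exact .head (hPQ _ ha) hf ih

theorem reaches (h : Run f P a b n) : StateTransition.Reaches f a b := by
  induction h with
  | refl _ => exact .refl
  | head _ hf _ ih => exact .head hf ih

theorem of_reaches (h : StateTransition.Reaches f a b)
    (hP : ∀ c, StateTransition.Reaches f a c → P c) : ∃ n, Run f P a b n := by
  induction h using Relation.ReflTransGen.head_induction_on with
  | refl => exact ⟨0, .refl (hP _ .refl)⟩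
  | head hf _ ih =>
    obtain ⟨n, hn⟩ := ih fun c hc => hP c (.head hf hc)
    exact ⟨n + 1, .head (hP _ .refl) hf hn⟩

/-- A run that ends in a halted state visits all reachable states. -/
theorem of_reaches_of_halt (h : Run f P a b n) (hb : f b = none) (hc : StateTransition.Reaches f a c) :
    P c := by
  induction h with
  | refl ha =>
    rcases Relation.ReflTransGen.cases_head hc with rfl | ⟨d, hd, _⟩
    · exact ha
    · simp [hb] at hd
  | head ha hf _ ih =>
    rcases Relation.ReflTransGen.cases_head hc with rfl | ⟨d, hd, hdc⟩
    · exact ha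
    · rw [hf] at hd
      cases hd
      exact ih hb hdc

theorem iterate_eq (h : Run f P a b n) : (flip bind f)^[n] (some a) = some b := by
  induction h with
  | refl _ => rfl
  | head _ hf _ ih =>
    rw [Function.iterate_succ_apply, ← ih]
    exact congrArg _ hf

theorem of_iterate_eq (h : (flip bind f)^[n] (some a) = some b) :
    Run f (fun _ => True) a b n := by
  induction n generalizing a with
  | zero => cases h; exact .refl trivial
  | succ n ih =>
    rw [Function.iterate_succ_apply] at h
    cases hf : f a with
    | none =>
      have h' : (flip bind f)^[n] none = some b := by rw [← h]; congr 1; simp [flip, hf]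
      have : (flip bind f)^[n] none = none := Function.iterate_fixed rfl n
      rw [this] at h'
      cases h'
    | some c =>
      have h' : (flip bind f)^[n] (some c) = some b := by rw [← h]; congr 1; simp [flip, hf]
      exact .head trivial hf (ih h')

/-- Along a simulation, in which each step costs at most `B` steps, runs are carried over. -/
theorem simulate {β : Type*} {g : β → Option β} {R : β → Prop} (e : α → β) (B : ℕ)
    (hsim : ∀ x y, P x → f x = some y → P y → ∃ k ≤ B, Run g R (e x) (e y) k)
    (hR : ∀ x, P x → R (e x)) (h : Run f P a b n) : ∃ k ≤ n * B, Run g R (e a) (e b) k := by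
  induction h with
  | refl ha => exact ⟨0, by simp, .refl (hR _ ha)⟩
  | head ha hf hr ih =>
    obtain ⟨k₁, hk₁, h₁⟩ := hsim _ _ ha hf hr.left
    obtain ⟨k₂, hk₂, h₂⟩ := ih
    exact ⟨k₁ + k₂, by rw [Nat.succ_mul]; omega, h₁.trans h₂⟩

/-- By determinism the distance to a halted state depends only on the starting state. It thus tells
apart the states along a run. -/
theorem length_unique (h₁ : Run f P a b m) (hb : f b = none) (h₂ : Run f P a b n) : m = n := by
  induction h₁ generalizing n with
  | refl _ =>
    cases h₂ with
    | refl _ => rfl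
    | head _ hf _ => simp [hb] at hf
  | head _ hf _ ih =>
    cases h₂ with
    | refl _ => simp [hb] at hf
    | head _ hf' h' =>
      rw [hf] at hf'
      cases hf'
      rw [ih hb h']

theorem exists_nodup_list (h : Run f P a b n) (hb : f b = none) :
    ∃ l : List α, l.length = n + 1 ∧ l.Nodup ∧ ∀ x ∈ l, P x ∧ ∃ k ≤ n, Run f P x b k := by
  induction h with
  | refl ha => exact ⟨[_], rfl, by simp, by simpa using ⟨ha, .refl ha⟩⟩
  | @head a d c n ha hf hr ih =>
    obtain ⟨l, hl, hnd, hx⟩ := ih hb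
    -- A recurrence of `a` in `l` would give it a second, shorter distance to `b`.
    refine ⟨a :: l, by simp [hl], List.nodup_cons.2 ⟨fun hal => ?_, hnd⟩, ?_⟩
    · obtain ⟨-, k, hk, hrun⟩ := hx a hal
      have := length_unique hrun hb (.head ha hf hr)
      omega
    · rintro x (_ | ⟨_, hxl⟩)
      · exact ⟨ha, _, le_rfl, .head ha hf hr⟩
      · obtain ⟨hP, k, hk, hrun⟩ := hx x hxl
        exact ⟨hP, k, by omega, hrun⟩

/-- In a run to a halted state no state is repeated. -/
theorem length_lt_ncard (h : Run f P a b n) (hb : f b = none) {T : Set α} (hT : T.Finite)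
    (hPT : ∀ x, P x → x ∈ T) : n < T.ncard := by
  classical
  obtain ⟨l, hl, hnd, hx⟩ := exists_nodup_list h hb
  have h1 : (l.toFinset : Set α) ⊆ T := fun x hxl => hPT x (hx x (by simpa using hxl)).1
  have h2 := Set.ncard_le_ncard h1 hT
  rw [Set.ncard_coe_finset, List.toFinset_card_of_nodup hnd, hl] at h2
  omega

end Run

/-! ### Machines -/

namespace OracleTM

variable {M : OracleTM} {A L : Set (List Bool)}

theorem step_query (v : M.σ) (S : M.K → List Bool) [Decidable (S M.queryStack ∈ A)] :
    M.step A ⟨some M.query, v, S⟩ = some ⟨some (if S M.queryStack ∈ A then M.yes else M.no), v,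
      Function.update S M.queryStack []⟩ := by
  simp only [step, if_true]
  split_ifs <;> rfl

theorem step_of_ne {l : M.Λ} (h : l ≠ M.query) (v : M.σ) (S : M.K → List Bool) :
    M.step A ⟨some l, v, S⟩ = some (Turing.TM2.stepAux (M.program l) v S) := by
  simp [step, h]

theorem Answers.step_eq_none {x : List Bool} {c : M.Cfg} (h : M.Answers L x c) :
    M.step A c = none := by
  obtain ⟨l, v, S⟩ := c
  obtain ⟨rfl, -⟩ := h
  rfl

theorem decidesInSpace_iff {s : ℕ → ℕ} : M.DecidesInSpace A L s ↔ ∀ x : List Bool, ∃ c n,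
    M.Answers L x c ∧ Run (M.step A) (fun c => M.space c ≤ s x.length) (M.init x) c n := by
  constructor
  · intro h x
    obtain ⟨⟨c, hc, hr⟩, hs⟩ := h x
    obtain ⟨n, hn⟩ := Run.of_reaches hr hs
    exact ⟨c, n, hc, hn⟩
  · intro h x
    obtain ⟨c, n, hc, hr⟩ := h x
    exact ⟨⟨c, hc, hr.reaches⟩, fun d hd => hr.of_reaches_of_halt hc.step_eq_none hd⟩

theorem decidesInTime_iff {t : ℕ → ℕ} : M.DecidesInTime A L t ↔ ∀ x : List Bool, ∃ c, ∃ n ≤ t x.length,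
    M.Answers L x c ∧ Run (M.step A) (fun _ => True) (M.init x) c n := by
  constructor
  · intro h x
    obtain ⟨c, hc, ⟨⟨n, hn⟩, hle⟩⟩ := h x
    exact ⟨c, n, hle, hc, Run.of_iterate_eq hn⟩
  · intro h x
    obtain ⟨c, n, hle, hc, hr⟩ := h x
    exact ⟨c, hc, ⟨⟨⟨n, hr.iterate_eq⟩, hle⟩⟩⟩

end OracleTM

/-! ### Closure under complement -/

/-- The machine that asks the oracle whether it contains the input, and negates the answer. -/
def complementMachine : OracleTM where
  K := Unit
  Λ := Option Bool
  σ := Bool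
  input := ()
  queryStack := ()
  main := none
  initialState := false
  query := none
  yes := some true
  no := some false
  accept := id
  program l := .load (fun _ => l == some false) .halt

/-- One query suffices. In `complementMachine` the input stack is the query stack and the initial
label is the query label, so the first step already asks for `x`; nothing is ever pushed, whence the
bound `Polynomial.X`. -/
theorem compl_mem_of_PSPACEWithOracle_subset {C : Set (Set (List Bool))}
    (hC : PSPACEWithOracle C ⊆ C) {L : Set (List Bool)} (hL : L ∈ C) : Lᶜ ∈ C := by
  classical
  refine hC ⟨L, hL, complementMachine, Polynomial.X, OracleTM.decidesInSpace_iff.2 fun x => ?_⟩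
  have hinit : complementMachine.init x = ⟨some none, false, fun _ => x⟩ :=
    congrArg (Turing.TM2.Cfg.mk _ _) (funext fun _ => Function.update_self ..)
  refine ⟨⟨none, decide (x ∉ L), fun _ => []⟩, 2, ⟨rfl, by simp [complementMachine]⟩, ?_⟩
  rw [hinit]
  refine .head (b := ⟨some (some (decide (x ∈ L))), false, fun _ => []⟩) ?_ ?_ (.single ?_ ?_ ?_)
  · simp [OracleTM.space, show Fintype.card complementMachine.K = 1 from rfl]
  · refine (OracleTM.step_query (M := complementMachine) _ _).trans ?_
    have hupd : Function.update (fun _ : complementMachine.K => x) complementMachine.queryStack [] =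
        fun _ => [] := funext fun _ => Function.update_self ..
    rw [hupd]
    by_cases h : x ∈ L <;> simp [complementMachine, h]
  · simp [OracleTM.space]
  · refine (OracleTM.step_of_ne (M := complementMachine) (by simp [complementMachine]) _ _).trans ?_
    by_cases h : x ∈ L <;> simp [complementMachine, h, Turing.TM2.stepAux]
  · simp [OracleTM.space]

/-! ### Embedding programs into larger machines -/

namespace Turing.TM2

/-- The statement of a machine, as a statement of a larger machine, with stacks along `κ`, labels
along `lab`, and internal state accessed by `get` and `put`; `halt` is replaced by `h`. -/
def Stmt.embed {K K' Λ Λ' σ σ' : Type*} {Γ : K' → Type*} (κ : K → K') (get : σ' → σ)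
    (put : σ → σ' → σ') (lab : Λ → Λ') (h : Stmt Γ Λ' σ') :
    Stmt (fun k => Γ (κ k)) Λ σ → Stmt Γ Λ' σ'
  | .push k f q => .push (κ k) (fun s => f (get s)) (embed κ get put lab h q)
  | .peek k f q => .peek (κ k) (fun s o => put (f (get s) o) s) (embed κ get put lab h q)
  | .pop k f q => .pop (κ k) (fun s o => put (f (get s) o) s) (embed κ get put lab h q)
  | .load f q => .load (fun s => put (f (get s)) s) (embed κ get put lab h q)
  | .branch f q₁ q₂ =>
    .branch (fun s => f (get s)) (embed κ get put lab h q₁) (embed κ get put lab h q₂)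
  | .goto f => .goto fun s => lab (f (get s))
  | .halt => h

/-- `E` and `V` include the stores and internal states of the small machine in those of the large
one. The maps `get` and `put` need to behave well only on the image of `V`, so the other components
may be frozen at arbitrary values. -/
theorem stepAux_embed {K K' Λ Λ' σ σ' : Type*} {Γ : K' → Type*} [DecidableEq K] [DecidableEq K']
    {κ : K → K'} {get : σ' → σ} {put : σ → σ' → σ'} {lab : Λ → Λ'} {h : Stmt Γ Λ' σ'}
    (E : (∀ k, List (Γ (κ k))) → ∀ k, List (Γ k)) (hE : ∀ S k, E S (κ k) = S k)
    (hE' : ∀ S k x, Function.update (E S) (κ k) x = E (Function.update S k x))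
    (V : σ → σ') (hV : ∀ v, get (V v) = v) (hV' : ∀ v w, put w (V v) = V w)
    (q : Stmt (fun k => Γ (κ k)) Λ σ) (v : σ) (S : ∀ k, List (Γ (κ k))) :
    stepAux (Stmt.embed κ get put lab h q) (V v) (E S) =
      match stepAux q v S with
      | ⟨some l, w, T⟩ => ⟨some (lab l), V w, E T⟩
      | ⟨none, w, T⟩ => stepAux h (V w) (E T) := by
  induction q generalizing v S with
  | push k f q ih => simp only [Stmt.embed, stepAux, hV, hE, hE', ih]
  | peek k f q ih => simp only [Stmt.embed, stepAux, hV, hV', hE, ih]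
  | pop k f q ih => simp only [Stmt.embed, stepAux, hV, hV', hE, hE', ih]
  | load f q ih => simp only [Stmt.embed, stepAux, hV, hV', ih]
  | branch f q₁ q₂ ih₁ ih₂ =>
    simp only [Stmt.embed, stepAux, hV]
    cases f v
    · exact ih₂ v S
    · exact ih₁ v S
  | goto f => simp only [Stmt.embed, stepAux, hV]
  | halt => simp only [Stmt.embed, stepAux]

/-- The number of instructions of a statement. -/
def Stmt.size {K Λ σ : Type*} {Γ : K → Type*} : Stmt Γ Λ σ → ℕ
  | .push _ _ q | .peek _ _ q | .pop _ _ q | .load _ q => q.size + 1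
  | .branch _ q₁ q₂ => q₁.size + q₂.size + 1
  | .goto _ => 1
  | .halt => 1

/-- Each instruction pushes at most one symbol. Counting both arms of a branch in `size` is generous
but harmless. -/
theorem length_stepAux_le {K Λ σ : Type*} {Γ : K → Type*} [DecidableEq K] [Fintype K]
    (q : Stmt Γ Λ σ) (v : σ) (S : ∀ k, List (Γ k)) :
    ∑ k, ((stepAux q v S).stk k).length ≤ ∑ k, (S k).length + q.size := by
  induction q generalizing v S with
  | push k f q ih =>
    refine (ih _ _).trans ?_
    have : ∑ j, (Function.update S k (f v :: S k) j).length ≤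
        ∑ j, ((S j).length + if j = k then 1 else 0) := by
      refine Finset.sum_le_sum fun j _ => ?_
      by_cases hj : j = k
      · subst hj; simp
      · simp [hj]
    rw [Finset.sum_add_distrib] at this
    simp at this
    simp only [Stmt.size]
    omega
  | peek k f q ih => exact (ih _ _).trans (by simp only [Stmt.size]; omega)
  | pop k f q ih =>
    refine (ih _ _).trans ?_
    have : ∑ j, (Function.update S k (S k).tail j).length ≤ ∑ j, (S j).length := by
      refine Finset.sum_le_sum fun j _ => ?_
      by_cases hj : j = k
      · subst hj; simp
      · simp [hj]
    simp only [Stmt.size]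
    omega
  | load f q ih => exact (ih _ _).trans (by simp only [Stmt.size]; omega)
  | branch f q₁ q₂ ih₁ ih₂ =>
    simp only [stepAux]
    cases f v
    · exact (ih₂ v S).trans (by simp only [Stmt.size]; omega)
    · exact (ih₁ v S).trans (by simp only [Stmt.size]; omega)
  | goto f => simp [stepAux]
  | halt => simp [stepAux]

end Turing.TM2

/-! ### Prefixing the output of a polynomial-time function -/

open Turing in
/-- The machine that pushes `b` on the output stack before it halts. -/
def Turing.FinTM2.pushOutput (tm : FinTM2) (b : tm.Γ tm.k₁) : FinTM2 :=
  { tm with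
    m := fun l => .embed (Γ := tm.Γ) id id (fun s _ => s) id (.push tm.k₁ (fun _ => b) .halt) (tm.m l) }

theorem Turing.haltList_stk (tm : Turing.FinTM2) (s : List (tm.Γ tm.k₁)) :
    (Turing.haltList tm s).stk = Function.update (fun _ => []) tm.k₁ s := by
  funext k
  by_cases hk : k = tm.k₁
  · subst hk
    rw [Function.update_self]
    exact dif_pos rfl
  · rw [Function.update_of_ne hk]
    exact dif_neg hk

-- The extra push belongs to the very step that halts, so the number of steps, and with it the time
-- bound, does not change.
open Turing in
theorem PolyTimeComputable.cons (b : Bool) {f : List Bool → List Bool} (hf : PolyTimeComputable f) :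
    PolyTimeComputable fun x => b :: f x := by
  obtain ⟨⟨⟨tm, iα, oα⟩, time, out⟩⟩ := hf
  refine ⟨⟨⟨tm.pushOutput (oα.symm b), iα, oα⟩, time, fun x => ⟨⟨(out x).steps, ?_⟩, (out x).steps_le_m⟩⟩⟩
  -- Corresponding configurations differ only after halting.
  let g : tm.Cfg → tm.Cfg := fun c => match c with
    | ⟨some l, v, S⟩ => ⟨some l, v, S⟩
    | ⟨none, v, S⟩ => ⟨none, v, Function.update S tm.k₁ (oα.symm b :: S tm.k₁)⟩
  have hstep : ∀ c, (tm.pushOutput (oα.symm b)).step (g c) = (tm.step c).map g := by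
    rintro ⟨_ | l, v, S⟩
    · rfl
    · refine congrArg some ((TM2.stepAux_embed (κ := id) (lab := id) id (fun _ _ => rfl)
        (fun _ _ _ => rfl) id (fun _ => rfl) (fun _ _ => rfl) (tm.m l) v S).trans ?_)
      change _ = g (TM2.stepAux (tm.m l) v S)
      rcases TM2.stepAux (tm.m l) v S with ⟨_ | l', w, T⟩ <;> rfl
  have hiter : ∀ n c, (flip bind (tm.pushOutput (oα.symm b)).step)^[n] (Option.map g c) =
      ((flip bind tm.step)^[n] c).map g := by
    intro n
    induction n with
    | zero => intro c; rfl
    | succ n ih =>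
      intro c
      rw [Function.iterate_succ_apply, Function.iterate_succ_apply, ← ih]
      congr 1
      cases c with
      | none => rfl
      | some c => exact hstep c
  have h := hiter (out x).steps (some (initList tm (List.map iα.invFun x)))
  refine Eq.trans ?_ (h.trans ((congrArg (Option.map g) (out x).evals_in_steps).trans ?_))
  · rfl
  · refine congrArg some (congrArg (TM2.Cfg.mk _ _) ?_)
    refine Eq.trans ?_ (haltList_stk (tm.pushOutput (oα.symm b)) _).symm
    have h := haltList_stk tm (List.map oα.invFun (f x))
    change Function.update (haltList tm _).stk tm.k₁ (oα.symm b :: (haltList tm _).stk tm.k₁) = _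
    rw [h, Function.update_self, Function.update_idem]
    rfl

/-! ### Answering oracle queries by a machine -/

namespace OracleTM

/-- Pops each of the stacks `κ k`, for `k` in the list, and records in the flag whether there was
anything to pop. -/
def popAll {K K' Λ σ τ : Type*} (κ : K → K') (q : Turing.TM2.Stmt (fun _ : K' => Bool) Λ (σ × τ × Bool)) :
    List K → Turing.TM2.Stmt (fun _ : K' => Bool) Λ (σ × τ × Bool)
  | [] => q
  | k :: ks => .pop (κ k) (fun s o => (s.1, s.2.1, s.2.2 || o.isSome)) (popAll κ q ks)

theorem stepAux_popAll {K K' Λ σ τ : Type*} [DecidableEq K] [DecidableEq K'] {κ : K → K'}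
    (E : (K → List Bool) → K' → List Bool) (hE : ∀ S k, E S (κ k) = S k)
    (hE' : ∀ S k x, Function.update (E S) (κ k) x = E (Function.update S k x))
    (q : Turing.TM2.Stmt (fun _ : K' => Bool) Λ (σ × τ × Bool)) (ks : List K) (hks : ks.Nodup)
    (v : σ) (w : τ) (b : Bool) (S : K → List Bool) :
    Turing.TM2.stepAux (popAll κ q ks) (v, w, b) (E S) =
      Turing.TM2.stepAux q (v, w, b || ks.any fun k => (S k).head?.isSome)
        (E fun k => if k ∈ ks then (S k).tail else S k) := by
  induction ks generalizing b S with
  | nil => simp [popAll]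
  | cons k ks ih =>
    obtain ⟨hk, hks⟩ := List.nodup_cons.1 hks
    simp only [popAll, Turing.TM2.stepAux, hE, hE', ih hks]
    congr 1
    · simp only [List.any_cons, Bool.or_assoc]
      congr 4
      rw [Bool.eq_iff_iff]
      simp only [List.any_eq_true]
      refine exists_congr fun j => and_congr_right fun hj => ?_
      rw [Function.update_of_ne (ne_of_mem_of_not_mem hj hk)]

    · congr 1
      funext j
      by_cases hj : j = k
      · subst hj; simp [hk]
      · simp [hj]

variable (M N : OracleTM)

/-- The stacks of `N` as stacks of the composition: the input of `N` is on the query stack of `M`. -/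
def stackMap (k : N.K) : M.K ⊕ N.K := if k = N.input then .inl M.queryStack else .inr k

open Classical in
/-- The machine that works like `M` and runs `N` to answer the oracle queries. -/
noncomputable def comp : OracleTM where
  K := M.K ⊕ N.K
  Λ := M.Λ ⊕ Option N.Λ
  σ := M.σ × N.σ × Bool
  input := .inl M.input
  queryStack := stackMap M N N.queryStack
  main := .inl M.main
  initialState := (M.initialState, N.initialState, false)
  query := .inr (some N.query)
  yes := .inr (some N.yes)
  no := .inr (some N.no)
  accept s := M.accept s.1
  program
    | .inl l =>
      -- The query word already lies on the input stack of `N`, by the choice of `stackMap`, so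
      -- calling `N` is a mere jump.
      if l = M.query then .goto fun _ => .inr (some N.main)
      else .embed (Γ := fun _ => Bool) Sum.inl Prod.fst (fun v s => (v, s.2)) Sum.inl .halt
        (M.program l)
    | .inr (some l) =>
      .embed (Γ := fun _ => Bool) (stackMap M N) (fun s => s.2.1) (fun w s => (s.1, w, s.2.2))
        (fun l => .inr (some l)) (.goto fun _ => .inr none) (N.program l)
    -- Clean-up after `N` has halted: each round pops every stack of `N` once. A round that finds
    -- nothing to pop resets the state of `N` and returns the answer to `M`.
    | .inr none =>
      .load (fun s => (s.1, s.2.1, false)) <| popAll (stackMap M N)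
        (.branch (fun s => s.2.2) (.goto fun _ => .inr none)
          (.branch (fun s => N.accept s.2.1)
            (.load (fun s => (s.1, N.initialState, false)) (.goto fun _ => .inl M.yes))
            (.load (fun s => (s.1, N.initialState, false)) (.goto fun _ => .inl M.no))))
        (Finset.univ : Finset N.K).toList

variable {M N}

/-- The stacks of the composition while `N` runs. -/
def joinStacks (S : M.K → List Bool) (T : N.K → List Bool) : M.K ⊕ N.K → List Bool :=
  Sum.elim (Function.update S M.queryStack (T N.input)) (Function.update T N.input [])

theorem joinStacks_stackMap (S : M.K → List Bool) (T : N.K → List Bool) (k : N.K) :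
    joinStacks S T (stackMap M N k) = T k := by
  unfold joinStacks stackMap
  split_ifs with h
  · simp [h]
  · simp [h]

theorem update_joinStacks (S : M.K → List Bool) (T : N.K → List Bool) (k : N.K) (x : List Bool) :
    Function.update (joinStacks S T) (stackMap M N k) x = joinStacks S (Function.update T k x) := by
  unfold joinStacks stackMap
  split_ifs with h
  · subst h
    simp only [Sum.update_elim_inl, Function.update_idem, Function.update_self]
  · rw [Sum.update_elim_inr, Function.update_comm (Ne.symm h),
      Function.update_of_ne (Ne.symm h)]

theorem sum_joinStacks_le (S : M.K → List Bool) (T : N.K → List Bool) :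
    ∑ k, (joinStacks S T k).length ≤ ∑ k, (S k).length + ∑ k, (T k).length := by
  have h₁ : ∑ k, (Function.update S M.queryStack (T N.input) k).length ≤
      ∑ k, ((S k).length + if k = M.queryStack then (T N.input).length else 0) := by
    refine Finset.sum_le_sum fun k _ => ?_
    by_cases hk : k = M.queryStack
    · subst hk; simp
    · simp [hk]
  have h₂ : ∑ k, (T k).length = ∑ k, ((Function.update T N.input [] k).length +
      if k = N.input then (T N.input).length else 0) := by
    refine Finset.sum_congr rfl fun k _ => ?_
    by_cases hk : k = N.input
    · subst hk; simp
    · simp [hk]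
  rw [Finset.sum_add_distrib] at h₁ h₂
  simp only [Finset.sum_ite_eq', Finset.mem_univ, if_true] at h₁ h₂
  rw [Fintype.sum_sum_type]
  simp only [joinStacks, Sum.elim_inl, Sum.elim_inr]
  omega

/-- The configuration of the composition while `M` is in the configuration `c`. -/
def outer (N : OracleTM) (c : M.Cfg) : (comp M N).Cfg :=
  ⟨c.l.map Sum.inl, (c.var, N.initialState, false), Sum.elim c.stk fun _ => []⟩

theorem space_outer (c : M.Cfg) : (comp M N).space (outer N c) = M.space c :=
  (Fintype.sum_sum_type _).trans (by simp [outer, space])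

/-- The configuration of the composition while `N` is in the configuration `d`, the state and the
stacks of `M` being `v` and `S`. -/
def inner (v : M.σ) (S : M.K → List Bool) (d : N.Cfg) : (comp M N).Cfg :=
  ⟨some (Sum.inr d.l), (v, d.var, false), joinStacks S d.stk⟩

/-- The label of `N` is kept as an option, so a halted `N` is at `.inr none`, which is the clean-up
label: the composition does not halt with `N`. Queries of `N` remain queries to the empty oracle. -/
theorem comp_step_inner (v : M.σ) (S : M.K → List Bool) {d d' : N.Cfg} (h : N.step ∅ d = some d') :
    (comp M N).step ∅ (inner v S d) = some (inner v S d') := by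
  obtain ⟨_ | l, w, T⟩ := d
  · cases h
  · by_cases hl : l = N.query
    · subst hl
      rw [step_query] at h
      cases h
      refine (step_query (M := comp M N) (A := ∅) _ _).trans (congrArg some ?_)
      refine congr (congr (congrArg _ ?_) rfl) (update_joinStacks S T _ _)
      simp [comp]
    · rw [step_of_ne hl] at h
      cases h
      refine (step_of_ne (M := comp M N) (A := ∅) (by simpa [comp] using hl) _ _).trans
        (congrArg some ?_)
      refine (Turing.TM2.stepAux_embed (κ := stackMap M N) (Γ := fun _ => Bool) (joinStacks S)
        (joinStacks_stackMap S) (update_joinStacks S) (fun w => (v, w, false)) (fun _ => rfl)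
        (fun _ _ => rfl) (N.program l) w T).trans ?_
      rcases Turing.TM2.stepAux (N.program l) w T with ⟨_ | l', w', T'⟩ <;> rfl

/-- Every round lowers all nonempty stacks of `N` by one. At most `m` rounds empty them, and one
more notices this; hence `m + 1`. -/
theorem comp_run_clear (B m : ℕ) (v : M.σ) (w : N.σ) (b : Bool) (S : M.K → List Bool) (T : N.K → List Bool)
    (hB : ∑ k, (S k).length + ∑ k, (T k).length ≤ B) (hT : ∀ k, (T k).length ≤ m) :
    ∃ n ≤ m + 1, Run ((comp M N).step ∅) (fun c => (comp M N).space c ≤ B)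
      ⟨some (.inr none), (v, w, b), joinStacks S T⟩
      (outer N ⟨some (if N.accept w then M.yes else M.no), v, Function.update S M.queryStack []⟩) n := by
  have hstep : ∀ b T, (comp M N).step ∅ ⟨some (.inr none), (v, w, b), joinStacks S T⟩ = some
      (if ∃ k, T k ≠ [] then ⟨some (.inr none), (v, w, true), joinStacks S fun k => (T k).tail⟩
      else outer N ⟨some (if N.accept w then M.yes else M.no), v,
        Function.update S M.queryStack []⟩) := by
    intro b T
    refine (step_of_ne (M := comp M N) (A := ∅) (by simp [comp]) _ _).trans (congrArg some ?_)
    refine (stepAux_popAll (κ := stackMap M N) (joinStacks S) (joinStacks_stackMap S) (update_joinStacks S) _ _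
      (Finset.nodup_toList _) v w false T).trans ?_
    simp only [Finset.mem_toList, Finset.mem_univ, if_true, Bool.false_or]
    by_cases h : ∃ k, T k ≠ []
    · rw [if_pos h]
      have : (Finset.univ : Finset N.K).toList.any (fun k => (T k).head?.isSome) = true := by
        simpa using h
      simp [this, Turing.TM2.stepAux]
      rfl
    · rw [if_neg h]
      have : (Finset.univ : Finset N.K).toList.any (fun k => (T k).head?.isSome) = false := by
        simpa using h
      push Not at h
      have hT : T = fun _ => [] := funext h
      have hst : joinStacks S (fun _ : N.K => []) =
          Sum.elim (Function.update S M.queryStack []) fun _ => [] := by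
        simp only [joinStacks]
        congr 1
        funext k
        by_cases hk : k = N.input
        · subst hk; exact Function.update_self ..
        · exact Function.update_of_ne hk ..
      subst hT
      cases hw : N.accept w <;> simp only [this, Turing.TM2.stepAux, hw, List.tail_nil, hst] <;> rfl
  have hend : (comp M N).space (outer N ⟨some (if N.accept w then M.yes else M.no), v,
      Function.update S M.queryStack []⟩) ≤ B := by
    have h : ∑ k, (Function.update S M.queryStack [] k).length ≤ ∑ k, (S k).length := by
      refine Finset.sum_le_sum fun k _ => ?_
      by_cases hk : k = M.queryStack
      · subst hk; simp
      · simp [hk]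
    exact (space_outer _).le.trans (h.trans ((Nat.le_add_right _ _).trans hB))
  induction m generalizing b T with
  | zero =>
    refine ⟨1, le_rfl, .single ((sum_joinStacks_le S T).trans hB) ((hstep b T).trans ?_) hend⟩
    rw [if_neg]
    rintro ⟨k, hk⟩
    exact hk (List.length_eq_zero_iff.1 (Nat.le_zero.1 (hT k)))
  | succ m ih =>
    by_cases h : ∃ k, T k ≠ []
    · obtain ⟨n, hn, hr⟩ := ih true (fun k => (T k).tail)
        ((Nat.add_le_add_left (Finset.sum_le_sum fun k _ => by simp) _).trans hB)
        (fun k => by simpa using hT k)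
      refine ⟨n + 1, by omega, .head ((sum_joinStacks_le S T).trans hB) ((hstep b T).trans ?_) hr⟩
      rw [if_pos h]
    · refine ⟨1, by omega, .single ((sum_joinStacks_le S T).trans hB) ((hstep b T).trans ?_) hend⟩
      rw [if_neg h]

/-- A query step of `M` costs one jump, at most `t` steps of `N`, and at most `r + 1` clean-up
rounds, as no stack of `N` is higher than its space `r`; hence the factor `t + r + 2`. The query
stack counts as space of `M`, so only words of length at most `s` are asked. -/
theorem comp_run {A : Set (List Bool)} {s r t : ℕ}
    (hN : ∀ q : List Bool, q.length ≤ s → ∃ d, ∃ n ≤ t, N.Answers A q d ∧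
      Run (N.step ∅) (fun d => N.space d ≤ r) (N.init q) d n)
    {c d : M.Cfg} {n : ℕ} (h : Run (M.step A) (fun c => M.space c ≤ s) c d n) :
    ∃ k ≤ n * (t + r + 2), Run ((comp M N).step ∅) (fun c => (comp M N).space c ≤ s + r)
      (outer N c) (outer N d) k := by
  have hout : ∀ c : M.Cfg, M.space c ≤ s → (comp M N).space (outer N c) ≤ s + r := by
    intro c hc
    exact (space_outer c).le.trans (hc.trans (Nat.le_add_right s r))
  refine h.simulate (outer N) (t + r + 2) ?_ hout
  rintro ⟨_ | l, v, S⟩ y hx hxy hy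
  · cases hxy
  by_cases hl : l = M.query
  · subst hl
    classical
    rw [step_query] at hxy
    have hq : (S M.queryStack).length ≤ s :=
      (Finset.single_le_sum (f := fun k => (S k).length) (fun _ _ => Nat.zero_le _)
        (Finset.mem_univ _)).trans hx
    obtain ⟨d, n, hn, ⟨hdl, hda⟩, hr⟩ := hN _ hq
    have hr' := hr.simulate (g := (comp M N).step ∅)
      (R := fun c => (comp M N).space c ≤ s + r) (inner v S) 1
      (fun x y hx hxy hy => ⟨1, le_rfl, .single ((sum_joinStacks_le S x.stk).trans (by exact add_le_add ‹_› hx))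
        (comp_step_inner v S hxy) ((sum_joinStacks_le S y.stk).trans (by exact add_le_add ‹_› hy))⟩)
      (fun x hx => (sum_joinStacks_le S x.stk).trans (by exact add_le_add ‹_› hx))
    obtain ⟨k, hk, hr'⟩ := hr'
    obtain ⟨_ | _, w, T⟩ := d
    swap
    · cases hdl
    have hT : ∑ k, (T k).length ≤ r := hr.right
    obtain ⟨j, hj, hc⟩ := comp_run_clear (M := M) (N := N) (s + r) r v w false S T
      (add_le_add hx hT)
      (fun k => (Finset.single_le_sum (f := fun k => (T k).length) (fun _ _ => Nat.zero_le _)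
        (Finset.mem_univ k)).trans hT)
    refine ⟨1 + (k + j), by omega, .trans (.single (hout _ hx) ?_ hr'.left) (hr'.trans ?_)⟩
    · refine (step_of_ne (M := comp M N) (A := ∅) (by simp [comp]) _ _).trans (congrArg some ?_)
      have hst : Sum.elim S (fun _ : N.K => []) = joinStacks S
          (Function.update (fun _ : N.K => []) N.input (S M.queryStack)) := by
        simp [joinStacks]
      simp only [inner, init, hst]
      simp [comp, Turing.TM2.stepAux]
    · cases hxy
      convert! hc using 6
      simp only at hda
      by_cases hA : S M.queryStack ∈ A
      · simp [hA, hda.2 hA]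
      · simp [hA, show N.accept w = false by simpa using mt hda.1 hA]
  · rw [step_of_ne hl] at hxy
    refine ⟨1, by omega, .single (hout _ hx) ?_ (hout _ hy)⟩
    refine (step_of_ne (M := comp M N) (A := ∅) (by simp [comp]) _ _).trans ?_
    rw [← Option.map_some (f := outer N), ← hxy]
    refine congrArg some ?_
    have hp : (comp M N).program (Sum.inl l) = .embed (Γ := fun _ => Bool) Sum.inl Prod.fst
        (fun v s => (v, s.2)) Sum.inl .halt (M.program l) := if_neg hl
    simp only [hp]
    refine (Turing.TM2.stepAux_embed (κ := Sum.inl) (Γ := fun _ => Bool)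
      (fun S => Sum.elim S fun _ : N.K => []) (fun _ _ => rfl) (fun _ _ _ => Sum.update_elim_inl)
      (fun v => (v, N.initialState, false)) (fun _ => rfl) (fun _ _ => rfl) (M.program l) v S).trans ?_
    rcases Turing.TM2.stepAux (M.program l) v S with ⟨_ | l', w', T'⟩ <;> rfl

end OracleTM

/-! ### The classes `k`-EXPSPACE and `k`-EXPTIME -/

theorem expTower_mono (k : ℕ) : Monotone (expTower k) := by
  induction k with
  | zero => exact monotone_id
  | succ k ih => exact fun a b h => Nat.pow_le_pow_right two_pos (ih h)

/-- An additive term sinks to the bottom of the tower, where it can be merged into the polynomial.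
The step uses `a + 2 ^ e ≤ (a + 1) * 2 ^ e ≤ 2 ^ a * 2 ^ e`. -/
theorem add_expTower_le (a k m : ℕ) : a + expTower k m ≤ expTower k (a + m) := by
  induction k with
  | zero => exact le_rfl
  | succ k ih =>
    refine le_trans ?_ (Nat.pow_le_pow_right two_pos ih)
    have h₁ : a + 1 ≤ 2 ^ a := Nat.lt_two_pow_self
    have h₂ : 1 ≤ 2 ^ expTower k m := Nat.one_le_two_pow
    rw [pow_add]
    change a + 2 ^ expTower k m ≤ _
    nlinarith

theorem Polynomial.eval_mono (p : Polynomial ℕ) : Monotone fun n => p.eval n := by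
  intro a b h
  simp only [Polynomial.eval_eq_sum_range]
  gcongr

/-! ### Counting configurations of bounded space, and bounding space by time -/

namespace OracleTM

variable {M : OracleTM} {A L : Set (List Bool)}

theorem ncard_space_le (M : OracleTM) (s : ℕ) :
    {c : M.Cfg | M.space c ≤ s}.Finite ∧ {c : M.Cfg | M.space c ≤ s}.ncard ≤
      (Fintype.card M.Λ + 1) * (Fintype.card M.σ * (3 ^ s) ^ Fintype.card M.K) := by
  -- A stack of height at most `s` is determined by the lookups at `s` positions, each with three
  -- possible results; this gives `3 ^ s` per stack.
  let g : M.Cfg → Option M.Λ × M.σ × (M.K → Fin s → Option Bool) :=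
    fun c => (c.l, c.var, fun k i => (c.stk k)[i.1]?)
  have hg : Set.InjOn g {c : M.Cfg | M.space c ≤ s} := by
    rintro ⟨l, v, S⟩ hS ⟨l', v', S'⟩ hS' h
    have hlen : ∀ (c : M.Cfg) k, M.space c ≤ s → (c.stk k).length ≤ s := fun c k hc =>
      (Finset.single_le_sum (f := fun k => (c.stk k).length) (fun _ _ => Nat.zero_le _)
        (Finset.mem_univ k)).trans hc
    simp only [g, Prod.mk.injEq] at h
    obtain ⟨rfl, rfl, h⟩ := h
    congr 1
    funext k
    refine List.ext_getElem? fun i => ?_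
    by_cases hi : i < s
    · exact congrFun (congrFun h k) ⟨i, hi⟩
    · rw [List.getElem?_eq_none ((hlen ⟨l, v, S⟩ k hS).trans (not_lt.1 hi)),
        List.getElem?_eq_none ((hlen ⟨l, v, S'⟩ k hS').trans (not_lt.1 hi))]
  refine ⟨Set.Finite.of_injOn (Set.mapsTo_univ g _) hg Set.finite_univ, ?_⟩
  refine (Set.ncard_le_ncard_of_injOn g (t := Set.univ) (fun _ _ => trivial) hg).trans (le_of_eq ?_)
  rw [Set.ncard_univ, Nat.card_eq_fintype_card]
  simp [Fintype.card_prod, Fintype.card_option]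

/-- A machine that is only bounded in time must also be bounded in space before `comp_run` applies
to it. -/
theorem exists_space_growth (M : OracleTM) : ∃ g : ℕ, ∀ (A : Set (List Bool)) (c d : M.Cfg),
    M.step A c = some d → M.space d ≤ M.space c + g := by
  classical
  refine ⟨∑ l, (M.program l).size, fun A c d h => ?_⟩
  obtain ⟨_ | l, v, S⟩ := c
  · cases h
  by_cases hl : l = M.query
  · subst hl
    rw [step_query] at h
    cases h
    refine (Finset.sum_le_sum fun k _ => ?_).trans (Nat.le_add_right _ _)
    by_cases hk : k = M.queryStack
    · subst hk; simp
    · simp [hk]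
  · rw [step_of_ne hl] at h
    cases h
    exact (Turing.TM2.length_stepAux_le _ v S).trans (Nat.add_le_add_left
      (Finset.single_le_sum (f := fun l => (M.program l).size) (fun _ _ => Nat.zero_le _)
        (Finset.mem_univ l)) _)

theorem space_init (M : OracleTM) (x : List Bool) : M.space (M.init x) = x.length := by
  have : ∀ k, (Function.update (fun _ : M.K => ([] : List Bool)) M.input x k).length =
      if k = M.input then x.length else 0 := by
    intro k
    by_cases hk : k = M.input
    · subst hk; simp
    · simp [hk]
  simp [space, init, this]

theorem run_space_of_run {g : ℕ} (hg : ∀ c d : M.Cfg, M.step A c = some d → M.space d ≤ M.space c + g)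
    {c d : M.Cfg} {n : ℕ} (h : Run (M.step A) (fun _ => True) c d n) :
    Run (M.step A) (fun e => M.space e ≤ M.space c + n * g) c d n := by
  induction h with
  | refl _ => exact .refl (by simp)
  | @head a b c n _ hf _ ih =>
    have := hg _ _ hf
    exact .head (by simp) hf (ih.mono fun x hx => by rw [Nat.succ_mul]; omega)

theorem outer_init {M N : OracleTM} (x : List Bool) : outer N (M.init x) = (comp M N).init x :=
  congrArg (Turing.TM2.Cfg.mk _ _) (Sum.update_elim_inl.symm.trans (by
    simp only [Sum.elim_lam_const_lam_const]; rfl))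

theorem Answers.outer {M N : OracleTM} {x : List Bool} {c : M.Cfg} (h : M.Answers L x c) :
    (comp M N).Answers L x (outer N c) :=
  ⟨by rw [OracleTM.outer, h.1]; rfl, h.2⟩

end OracleTM

open OracleTM

theorem PSPACEWithOracle_EXPSPACE_subset (k : ℕ) : PSPACEWithOracle (EXPSPACE k) ⊆ EXPSPACE k := by
  rintro L ⟨A, ⟨N, q, hN⟩, M, p, hM⟩
  rw [decidesInSpace_iff] at hM hN
  refine ⟨comp M N, p + q.comp p, decidesInSpace_iff.2 fun x => ?_⟩
  obtain ⟨c, n, hc, hr⟩ := hM x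
  choose d m hd hm using hN
  -- There are finitely many possible queries, so the running times of `N` on them have some bound.
  -- Its size is irrelevant for space.
  obtain ⟨t, ht⟩ := ((List.finite_length_le Bool (p.eval x.length)).image m).bddAbove
  obtain ⟨j, -, hj⟩ := comp_run (N := N) (A := A) (s := p.eval x.length)
    (r := expTower k (q.eval (p.eval x.length))) (t := t)
    (fun w hw => ⟨d w, m w, ht ⟨w, hw, rfl⟩, hd w,
      (hm w).mono fun e he => he.trans (expTower_mono k (q.eval_mono hw))⟩) hr
  rw [outer_init] at hj
  refine ⟨_, j, hc.outer, hj.mono fun e he => he.trans ?_⟩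
  simpa using add_expTower_le (p.eval x.length) k (q.eval (p.eval x.length))

/-- The running time is a product of two powers of 2, one for the number of steps of `M` and one for
the cost of a step. Their exponents add, and at least one level of exponentiation is needed to
absorb the first. -/
theorem PSPACEWithOracle_EXPTIME_subset (k : ℕ) :
    PSPACEWithOracle (EXPTIME (k + 1)) ⊆ EXPTIME (k + 1) := by
  rintro L ⟨A, ⟨N, q, hN⟩, M, p, hM⟩
  rw [decidesInSpace_iff] at hM
  rw [decidesInTime_iff] at hN
  obtain ⟨g, hg⟩ := N.exists_space_growth
  let a := (Fintype.card M.Λ + 1) * Fintype.card M.σ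
  let b := Fintype.card M.K
  refine ⟨comp M N, Polynomial.C (a + g + 3) + (Polynomial.C (2 * b) * p + p) + q.comp p,
    decidesInTime_iff.2 fun x => ?_⟩
  obtain ⟨c, n, hc, hr⟩ := hM x
  set s := p.eval x.length with hs
  set t := expTower (k + 1) (q.eval s) with ht
  obtain ⟨j, hj, hrj⟩ := comp_run (N := N) (A := A) (s := s) (r := s + t * g) (t := t)
    (fun w hw => by
      obtain ⟨d, m, hm, hd, hrd⟩ := hN w
      have hmt : m ≤ t := hm.trans (expTower_mono _ (q.eval_mono hw))
      refine ⟨d, m, hmt, hd, (run_space_of_run (hg ∅) hrd).mono fun e he => he.trans ?_⟩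
      rw [space_init]
      gcongr) hr
  rw [outer_init] at hrj
  refine ⟨_, j, hj.trans ?_, hc.outer, hrj.mono fun _ _ => trivial⟩
  have hn : n ≤ a * (3 ^ s) ^ b := by
    have h₁ := hr.length_lt_ncard hc.step_eq_none (M.ncard_space_le s).1 fun _ h => h
    have h₂ := (M.ncard_space_le s).2
    rw [← mul_assoc] at h₂
    exact h₁.le.trans h₂
  -- From `a ≤ 2 ^ a` and `3 ≤ 2 ^ 2`.
  have hn' : n ≤ 2 ^ (a + 2 * b * s) := by
    refine hn.trans ?_
    rw [pow_add]
    refine Nat.mul_le_mul Nat.lt_two_pow_self.le ?_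
    calc (3 ^ s) ^ b ≤ ((2 ^ 2) ^ s) ^ b := by gcongr; norm_num
      _ = 2 ^ (2 * b * s) := by rw [← pow_mul, ← pow_mul]; congr 1; ring
  -- As `1 ≤ t`, the left side is at most `(g + 3 + s) * t`, and `t` is itself a power of 2.
  have ht' : t + (s + t * g) + 2 ≤ 2 ^ (g + 3 + s + expTower k (q.eval s)) := by
    have h₁ : 1 ≤ t := Nat.one_le_two_pow
    rw [pow_add]
    change _ ≤ 2 ^ (g + 3 + s) * t
    have h₂ : g + 3 + s < 2 ^ (g + 3 + s) := Nat.lt_two_pow_self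
    nlinarith
  calc n * (t + (s + t * g) + 2)
      ≤ 2 ^ (a + 2 * b * s) * 2 ^ (g + 3 + s + expTower k (q.eval s)) := Nat.mul_le_mul hn' ht'
    _ = 2 ^ ((a + g + 3 + (2 * b * s + s)) + expTower k (q.eval s)) := by
      rw [← pow_add]; congr 1; ring
    _ ≤ 2 ^ expTower k ((a + g + 3 + (2 * b * s + s)) + q.eval s) :=
      Nat.pow_le_pow_right two_pos (add_expTower_le _ _ _)
    _ = _ := by
      simp only [Polynomial.eval_add, Polynomial.eval_mul, Polynomial.eval_C, Polynomial.eval_comp,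
        ← hs, expTower]

/-! ### A structured programming language for oracle machines -/

/-- Structured programs over stacks of bits. -/
inductive Prog (K : Type) : Type
  /-- do nothing -/
  | skip : Prog K
  /-- push a bit -/
  | push (k : K) (b : Bool) : Prog K
  /-- sequential composition -/
  | seq (p q : Prog K) : Prog K
  /-- pop a bit, and branch on it -/
  | pop (k : K) (p : Option Bool → Prog K) : Prog K
  /-- as long as the stack is not empty, pop a bit and run the program given by it -/
  | loop (k : K) (p : Bool → Prog K) : Prog K
  /-- consult the oracle, and branch on the answer -/
  | query (p : Bool → Prog K) : Prog K

namespace Prog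

variable {K : Type}

open Classical in
/-- With the oracle `A` and queries on the stack `qs`, the program `p` leads from the store `S` to
the store `S'`, and it never pushes anything on a stack that contains `s` bits. -/
inductive Exec [DecidableEq K] (A : Set (List Bool)) (qs : K) (s : ℕ) :
    Prog K → (K → List Bool) → (K → List Bool) → Prop
  | skip (S : K → List Bool) : Exec A qs s skip S S
  | push (S : K → List Bool) (k : K) (b : Bool) (h : (S k).length < s) :
    Exec A qs s (push k b) S (Function.update S k (b :: S k))
  | seq {p q : Prog K} {S T U : K → List Bool} :
    Exec A qs s p S T → Exec A qs s q T U → Exec A qs s (seq p q) S U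
  | pop {k : K} {p : Option Bool → Prog K} {S T : K → List Bool} :
    Exec A qs s (p (S k).head?) (Function.update S k (S k).tail) T → Exec A qs s (pop k p) S T
  | loop_nil {k : K} {p : Bool → Prog K} {S : K → List Bool} :
    S k = [] → Exec A qs s (loop k p) S S
  | loop_cons {k : K} {p : Bool → Prog K} {S T U : K → List Bool} {b : Bool} {w : List Bool} :
    S k = b :: w → Exec A qs s (p b) (Function.update S k w) T → Exec A qs s (loop k p) T U →
    Exec A qs s (loop k p) S U
  | query {p : Bool → Prog K} {S T : K → List Bool} :
    Exec A qs s (p (decide (S qs ∈ A))) (Function.update S qs []) T → Exec A qs s (query p) S T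

/-- The control points of a program. -/
def Label : Prog K → Type
  | skip => Unit
  | push _ _ => Unit
  | seq p q => Label p ⊕ Label q
  | pop _ p => Option (Σ o, Label (p o))
  | loop _ p => Option (Σ b, Label (p b))
  | query p => Option (Σ b, Label (p b))

instance Label.fintype : (p : Prog K) → Fintype (Label p)
  | skip => inferInstanceAs (Fintype Unit)
  | push _ _ => inferInstanceAs (Fintype Unit)
  | seq p q =>
    have := Label.fintype p
    have := Label.fintype q
    inferInstanceAs (Fintype (Label p ⊕ Label q))
  | pop _ p =>
    have := fun o => Label.fintype (p o)
    inferInstanceAs (Fintype (Option (Σ o, Label (p o))))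
  | loop _ p =>
    have := fun b => Label.fintype (p b)
    inferInstanceAs (Fintype (Option (Σ b, Label (p b))))
  | query p =>
    have := fun b => Label.fintype (p b)
    inferInstanceAs (Fintype (Option (Σ b, Label (p b))))

/-- The control point at which a program starts. -/
def entry : (p : Prog K) → Label p
  | skip => ()
  | push _ _ => ()
  | seq p _ => (Sum.inl (entry p) : Label p ⊕ _)
  | pop _ p => (none : Option (Σ o, Label (p o)))
  | loop _ p => (none : Option (Σ b, Label (p b)))
  | query p => (none : Option (Σ b, Label (p b)))

/-- The code of a program inside a machine that has its control points at `emb`, and in which the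
control goes to `ex` at the end of the program. The internal state contains the last bit that was
popped and the return addresses of an oracle call. -/
def code {Λ : Type} (q : Λ) : (p : Prog K) → (Label p → Λ) → Λ → Label p →
    Turing.TM2.Stmt (fun _ : K => Bool) Λ (Option Bool × (Bool → Λ))
  | skip, _, ex => fun _ => .goto fun _ => ex
  | push k b, _, ex => fun _ => .push k (fun _ => b) (.goto fun _ => ex)
  | seq p r, emb, ex => Sum.elim
    (code q p (fun l => emb (Sum.inl l : Label p ⊕ Label r)) (emb (Sum.inr (entry r) : Label p ⊕ Label r)))
    (code q r (fun l => emb (Sum.inr l : Label p ⊕ Label r)) ex)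
  | pop k p, emb, ex => fun l : Option (Σ o, Label (p o)) => l.elim
    (.pop k (fun s o => (o, s.2))
      (.goto fun s => emb (some ⟨s.1, entry (p s.1)⟩ : Option (Σ o, Label (p o)))))
    fun x => code q (p x.1) (fun l => emb (some ⟨x.1, l⟩ : Option (Σ o, Label (p o)))) ex x.2
  | loop k p, emb, ex => fun l : Option (Σ b, Label (p b)) => l.elim
    (.pop k (fun s o => (o, s.2)) (.goto fun s =>
      s.1.elim ex fun b => emb (some ⟨b, entry (p b)⟩ : Option (Σ b, Label (p b)))))
    fun x => code q (p x.1) (fun l => emb (some ⟨x.1, l⟩ : Option (Σ b, Label (p b))))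
      (emb (none : Option (Σ b, Label (p b)))) x.2
  | query p, emb, ex => fun l : Option (Σ b, Label (p b)) => l.elim
    (.load (fun s => (s.1, fun b => emb (some ⟨b, entry (p b)⟩ : Option (Σ b, Label (p b)))))
      (.goto fun _ => q))
    fun x => code q (p x.1) (fun l => emb (some ⟨x.1, l⟩ : Option (Σ b, Label (p b)))) ex x.2

variable [DecidableEq K] [Fintype K]

/-- The machine that runs the program `p` and accepts if there is `true` on top of the stack `out`
in the end. -/
abbrev machine (p : Prog K) (inp qs out : K) : OracleTM where
  K := K
  Λ := Label p ⊕ Option (Option Bool)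
  σ := Option Bool × (Bool → Label p ⊕ Option (Option Bool))
  input := inp
  queryStack := qs
  main := .inl (entry p)
  initialState := (none, fun _ => .inr none)
  query := .inr (some none)
  yes := .inr (some (some true))
  no := .inr (some (some false))
  accept s := s.1 == some true
  program
    | .inl l => code (.inr (some none)) p Sum.inl (.inr none) l
    | .inr (some none) => .halt
    | .inr (some (some b)) => .goto fun s => s.2 b
    | .inr none => .pop out (fun s o => (o, s.2)) .halt

/-- Correctness of the compiler, by induction on the execution. The statement is about a subprogram
`r` placed inside `p` by `emb` with exit `ex`, since the parts of a program have different exits: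
the body of a loop, for instance, exits to the head of the loop. -/
theorem Exec.run {A : Set (List Bool)} {s : ℕ} {p : Prog K} {inp qs out : K} {r : Prog K}
    {S T : K → List Bool} (h : Exec A qs s r S T) :
    ∀ (emb : Label r → Label p) (ex : Label p ⊕ Option (Option Bool)),
    (∀ l, (machine p inp qs out).program (.inl (emb l)) =
      code (.inr (some none)) r (fun l => .inl (emb l)) ex l) →
    (∀ k, (S k).length ≤ s) → ∀ v, ∃ v' n,
      Run ((machine p inp qs out).step A) (fun c => ∀ k, (c.stk k).length ≤ s)
        ⟨some (.inl (emb (entry r))), v, S⟩ ⟨some ex, v', T⟩ n := by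
  have hstep : ∀ {l : Label p} {v S c},
      Turing.TM2.stepAux ((machine p inp qs out).program (.inl l)) v S = c →
      (machine p inp qs out).step A ⟨some (.inl l), v, S⟩ = some c := by
    rintro l v S c rfl
    exact OracleTM.step_of_ne (M := machine p inp qs out) (by simp [machine]) _ _
  have hpop : ∀ {S : K → List Bool} {k : K} {w : List Bool}, (∀ k, (S k).length ≤ s) →
      w.length ≤ (S k).length → ∀ j, (Function.update S k w j).length ≤ s := by
    intro S k w hS hw j
    by_cases hj : j = k
    · subst hj; simpa using hw.trans (hS j)
    · simpa [hj] using hS j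
  induction h with
  | skip S =>
    intro emb ex hemb hS v
    exact ⟨v, 1, .single hS (hstep (by rw [hemb]; rfl)) hS⟩
  | push S k b h =>
    intro emb ex hemb hS v
    refine ⟨v, 1, .single hS (hstep (by rw [hemb]; rfl)) fun j => ?_⟩
    by_cases hj : j = k
    · subst hj; simpa using h
    · simpa [hj] using hS j
  | @seq p₁ p₂ S T U h₁ h₂ ih₁ ih₂ =>
    intro emb ex hemb hS v
    obtain ⟨v₁, n₁, r₁⟩ := ih₁ (fun l => emb (Sum.inl l : Label p₁ ⊕ Label p₂))
      (.inl (emb (Sum.inr (entry p₂) : Label p₁ ⊕ Label p₂)))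
      (fun l => hemb (Sum.inl l : Label p₁ ⊕ Label p₂)) hS v
    obtain ⟨v₂, n₂, r₂⟩ := ih₂ (fun l => emb (Sum.inr l : Label p₁ ⊕ Label p₂)) ex
      (fun l => hemb (Sum.inr l : Label p₁ ⊕ Label p₂)) r₁.right v₁
    exact ⟨v₂, _, r₁.trans r₂⟩
  | @pop k p' S T h ih =>
    intro emb ex hemb hS v
    obtain ⟨v', n, hr⟩ := ih (fun l => emb (some ⟨_, l⟩ : Option (Σ o, Label (p' o)))) ex
      (fun l => hemb (some ⟨_, l⟩ : Option (Σ o, Label (p' o)))) (hpop hS (by simp))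
      ((S k).head?, v.2)
    exact ⟨v', n + 1, .head hS (hstep (by rw [hemb]; rfl)) hr⟩
  | @loop_nil k p' S h =>
    intro emb ex hemb hS v
    refine ⟨(none, v.2), 1, .single hS (hstep ?_) hS⟩
    rw [hemb]
    simp only [code, entry, Turing.TM2.stepAux, h, List.head?_nil, List.tail_nil, Option.elim_none]
    rw [← h, Function.update_eq_self]
  | @loop_cons k p' S T U b w h h₁ h₂ ih₁ ih₂ =>
    intro emb ex hemb hS v
    obtain ⟨v₁, n₁, r₁⟩ := ih₁ (fun l => emb (some ⟨_, l⟩ : Option (Σ b, Label (p' b))))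
      (.inl (emb (none : Option (Σ b, Label (p' b)))))
      (fun l => hemb (some ⟨_, l⟩ : Option (Σ b, Label (p' b)))) (hpop hS (by simp [h]))
      (some b, v.2)
    obtain ⟨v₂, n₂, r₂⟩ := ih₂ emb ex hemb r₁.right v₁
    refine ⟨v₂, _, .head hS (hstep ?_) (r₁.trans r₂)⟩
    rw [hemb]
    refine Eq.trans (b := ⟨some ((S k).head?.elim ex fun b => .inl (emb (some ⟨b, entry (p' b)⟩ :
      Option (Σ b, Label (p' b))))), ((S k).head?, v.2), Function.update S k (S k).tail⟩) rfl ?_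
    rw [h]
    rfl
  | @query p' S T h ih =>
    classical
    intro emb ex hemb hS v
    have hS' := hpop (k := qs) (w := []) hS (by simp)
    obtain ⟨v', n, hr⟩ := ih (fun l => emb (some ⟨_, l⟩ : Option (Σ b, Label (p' b)))) ex
      (fun l => hemb (some ⟨_, l⟩ : Option (Σ b, Label (p' b)))) hS'
      (v.1, fun b => .inl (emb (some ⟨b, entry (p' b)⟩ : Option (Σ b, Label (p' b)))))
    -- All queries of a program share the labels `yes` and `no`; these jump to the return address
    -- deposited in the internal state before the query.
    have hans : (machine p inp qs out).step A
        ⟨some (.inr (some (some (decide (S qs ∈ A))))), (v.1, fun b => .inl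
          (emb (some ⟨b, entry (p' b)⟩ : Option (Σ b, Label (p' b))))), Function.update S qs []⟩ =
        some _ :=
      OracleTM.step_of_ne (M := machine p inp qs out) (by simp) _ _
    refine ⟨v', _, .head hS (hstep (by rw [hemb])) (.head hS ?_ (.head hS' hans hr))⟩
    refine (OracleTM.step_query (M := machine p inp qs out) (A := A) _ _).trans (congrArg some ?_)
    refine congr (congr (congrArg _ ?_) rfl) rfl
    by_cases hA : S qs ∈ A <;> simp [hA]

/-- `Exec` bounds each stack separately, whence the factor `Fintype.card K`. -/
theorem decidesInSpace_machine {A L : Set (List Bool)} {p : Prog K} {inp qs out : K} {s : ℕ → ℕ}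
    (hs : ∀ n, n ≤ s n)
    (h : ∀ x : List Bool, ∃ T, Exec A qs (s x.length) p (Function.update (fun _ => []) inp x) T ∧
      ((T out).head? = some true ↔ x ∈ L)) :
    (machine p inp qs out).DecidesInSpace A L fun n => Fintype.card K * s n := by
  refine OracleTM.decidesInSpace_iff.2 fun x => ?_
  obtain ⟨T, hT, hout⟩ := h x
  obtain ⟨v, n, hr⟩ := hT.run (p := p) (inp := inp) (out := out) id (.inr none) (fun l => rfl)
    (fun k => by
      by_cases hk : k = inp
      · subst hk; simpa using hs x.length
      · simp [hk]) (none, fun _ => .inr none)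
  have hfin : ∀ k, (Function.update T out (T out).tail k).length ≤ s x.length := fun k => by
    refine le_trans ?_ (hr.right k)
    by_cases hk : k = out
    · subst hk; simp
    · simp [hk]
  refine ⟨⟨none, ((T out).head?, v.2), Function.update T out (T out).tail⟩, n + 1,
    ⟨rfl, by simpa [machine] using hout⟩, ((hr.trans (.single hr.right ?_ hfin)).mono ?_)⟩
  · exact OracleTM.step_of_ne (M := machine p inp qs out) (by simp [machine]) _ _
  · intro c hc
    exact (Finset.sum_le_card_nsmul (Finset.univ : Finset K) (fun k => (c.stk k).length) _
      fun k _ => hc k).trans (le_of_eq (by simp))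

end Prog

/-! ### Splitting words -/

/-- Splits off a self-delimiting word. -/
def unword : List Bool → List Bool × List Bool
  | true :: b :: r => (b :: (unword r).1, (unword r).2)
  | false :: r => ([], r)
  | [true] => ([], [])
  | [] => ([], [])

theorem unword_delimit_append (w r : List Bool) : unword (delimit w ++ r) = (w, r) := by
  induction w with
  | nil => simp [delimit, unword]
  | cons b w ih =>
    have : delimit (b :: w) ++ r = true :: b :: (delimit w ++ r) := by simp [delimit]
    rw [this, unword, ih]

/-- Every bit of the word read costs two bits of input. This holds for malformed input too, on which
the program also has to respect its space bound. -/
theorem length_unword_le (w : List Bool) :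
    2 * (unword w).1.length + (unword w).2.length ≤ w.length := by
  induction w using unword.induct with
  | case1 b r ih => simp only [unword, List.length_cons]; omega
  | case2 r => simp [unword]
  | case3 => simp [unword]
  | case4 => simp [unword]

theorem length_unword_snd_lt {w : List Bool} (h : w ≠ []) :
    (unword w).2.length < w.length := by
  induction w using unword.induct with
  | case1 b r ih =>
    have := length_unword_le r
    simp only [unword, List.length_cons]
    omega
  | case2 r => simp [unword]
  | case3 => simp [unword]
  | case4 => exact absurd rfl h

/-- The words of a sequence of self-delimiting words. -/
def words (w : List Bool) : List (List Bool) :=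
  if h : w = [] then [] else
    have := length_unword_snd_lt h
    (unword w).1 :: words (unword w).2
termination_by w.length

@[simp]
theorem words_nil : words [] = [] := by
  rw [words, dif_pos rfl]

theorem words_of_ne_nil {w : List Bool} (h : w ≠ []) :
    words w = (unword w).1 :: words (unword w).2 := by
  rw [words, dif_neg h]

theorem words_seqCode (ws : List (List Bool)) : words (seqCode ws) = ws := by
  induction ws with
  | nil => simp [seqCode]
  | cons w ws ih =>
    have h : seqCode (w :: ws) = delimit w ++ seqCode ws := by simp [seqCode]
    rw [words_of_ne_nil (by simp [h, delimit]), h, unword_delimit_append, ih]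

theorem length_delimit (w : List Bool) : (delimit w).length = 2 * w.length + 1 := by
  simp [delimit, List.length_flatMap, mul_comm]

/-- Recoding malformed input may lengthen it, because a missing end mark is supplied. The sum of
`length_unword_le` and the strict decrease of the rest pays for the end mark at each word. -/
theorem length_seqCode_words_le (w : List Bool) : (seqCode (words w)).length ≤ 2 * w.length := by
  induction h : w.length using Nat.strong_induction_on generalizing w with
  | _ n ih =>
    by_cases hw : w = []
    · subst hw; simp [seqCode]
    · have h₁ := length_unword_snd_lt hw
      have h₂ := length_unword_le w
      have h₃ := ih _ (h ▸ h₁) _ rfl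
      rw [words_of_ne_nil hw]
      have h₄ : seqCode ((unword w).1 :: words (unword w).2) =
          delimit (unword w).1 ++ seqCode (words (unword w).2) := by simp [seqCode]
      rw [h₄, List.length_append, length_delimit]
      omega

/-! ### Basic programs -/

namespace Prog

open Function

variable {K : Type} [DecidableEq K] {A : Set (List Bool)} {qs : K} {s : ℕ}
  {a b f g t w : K} {S T U : K → List Bool}

/-- Nested updates can be normalised stack by stack, without rewriting stores. -/
theorem Exec.of_eq {p : Prog K} (h : Exec A qs s p S T) (hT : ∀ k, T k = U k) :
    Exec A qs s p S U :=
  (funext hT : T = U) ▸ h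

/-- Pops everything from the stack `a`. -/
def clear (a : K) : Prog K := loop a fun _ => skip

theorem exec_clear : Exec A qs s (clear a) S (update S a []) := by
  generalize hw : S a = u
  induction u generalizing S with
  | nil => exact (Exec.loop_nil hw).of_eq (by grind [update_apply])
  | cons x u ih =>
    exact (Exec.loop_cons hw (.skip _) (ih (S := update S a u) (by simp))).of_eq (by simp)

/-- Moves the stack `a` on top of the stack `b`, which reverses it. -/
def move (a b : K) : Prog K := loop a fun x => push b x

theorem exec_move (hab : a ≠ b) (hs : (S a).length + (S b).length ≤ s) :
    Exec A qs s (move a b) S (update (update S a []) b ((S a).reverse ++ S b)) := by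
  generalize hw : S a = u
  induction u generalizing S with
  | nil => exact (Exec.loop_nil hw).of_eq (by grind [update_apply])
  | cons x u ih =>
    rw [hw, List.length_cons] at hs
    refine (Exec.loop_cons (T := update (update S a u) b (x :: S b)) hw
      ((Exec.push _ _ _ ?_).of_eq ?_) (ih ?_ ?_)).of_eq ?_
    all_goals grind [update_apply]

/-- Moves the stack `t` on top of both `a` and `b`. -/
def moveBoth (t a b : K) : Prog K := loop t fun x => seq (push a x) (push b x)

theorem exec_moveBoth (hta : t ≠ a) (htb : t ≠ b) (hab : a ≠ b)
    (hsa : (S t).length + (S a).length ≤ s) (hsb : (S t).length + (S b).length ≤ s) :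
    Exec A qs s (moveBoth t a b) S
      (update (update (update S t []) a ((S t).reverse ++ S a)) b ((S t).reverse ++ S b)) := by
  generalize hw : S t = u
  induction u generalizing S with
  | nil => exact (Exec.loop_nil hw).of_eq (by grind [update_apply])
  | cons x u ih =>
    rw [hw, List.length_cons] at hsa hsb
    refine (Exec.loop_cons (T := update (update (update S t u) a (x :: S a)) b (x :: S b)) hw
      ((Exec.seq (.push _ _ _ ?_) (.push _ _ _ ?_)).of_eq ?_) (ih ?_ ?_ ?_)).of_eq ?_
    all_goals grind [update_apply]

/-- Copies the stack `a` on top of the stack `b`, with the auxiliary stack `t`. -/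
def copy (a b t : K) : Prog K := seq (move a t) (moveBoth t a b)

theorem exec_copy (hat : a ≠ t) (hbt : b ≠ t) (hab : a ≠ b) (ht : S t = [])
    (hs : (S a).length + (S b).length ≤ s) :
    Exec A qs s (copy a b t) S (update S b (S a ++ S b)) := by
  refine (Exec.seq (exec_move hat ?_) (exec_moveBoth hat.symm hbt.symm hab ?_ ?_)).of_eq ?_
  all_goals grind [update_apply]

/-- Reads one self-delimiting word, the mark on `g` standing for the control. -/
def readWord (a t g : K) : Prog K :=
  loop g fun _ => pop a fun
    | some true => pop a fun
      | some x => seq (push t x) (push g true)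
      | none => skip
    | _ => skip

/-- The mark on `g` is consumed in every round and put back only after a further bit has been read,
so the loop ends with the word. The bits end up on `t` in reverse. -/
theorem exec_readWord (hat : a ≠ t) (hga : g ≠ a) (hgt : g ≠ t) (hg : S g = [true])
    (hs : (S a).length + (S t).length ≤ s) : Exec A qs s (readWord a t g) S
      (update (update (update S g []) a (unword (S a)).2) t ((unword (S a)).1.reverse ++ S t)) := by
  generalize hu : S a = u
  induction u using unword.induct generalizing S with
  | case1 x r ih =>
    refine (Exec.loop_cons (T := update (update S a r) t (x :: S t)) hg (.pop ?_)
      (ih ?_ ?_ ?_)).of_eq ?_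
    · rw [update_of_ne hga.symm, hu]
      refine .pop ?_
      rw [update_self]
      refine (Exec.seq (.push _ _ _ ?_) (.push _ _ _ ?_)).of_eq ?_
      all_goals grind [update_apply]
    all_goals grind [update_apply, unword]
  | case2 r =>
    refine (Exec.loop_cons (T := update (update S g []) a r) hg (.pop ?_) (.loop_nil ?_)).of_eq ?_
    · rw [update_of_ne hga.symm, hu]
      exact .skip _
    all_goals grind [update_apply, unword]
  | case3 =>
    refine (Exec.loop_cons (T := update (update S g []) a []) hg (.pop ?_) (.loop_nil ?_)).of_eq ?_
    · rw [update_of_ne hga.symm, hu]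
      refine .pop ?_
      rw [update_self]
      exact (Exec.skip _).of_eq (by simp)
    all_goals grind [update_apply, unword]
  | case4 =>
    refine (Exec.loop_cons (T := update (update S g []) a []) hg (.pop ?_) (.loop_nil ?_)).of_eq ?_
    · rw [update_of_ne hga.symm, hu]
      exact .skip _
    all_goals grind [update_apply, unword]

/-- Moves the self-delimiting word on top of the stack `a` to the empty stack `b`. -/
def popWord (a b t g : K) : Prog K := seq (push g true) (seq (readWord a t g) (move t b))

theorem exec_popWord (hat : a ≠ t) (hbt : b ≠ t) (hab : a ≠ b) (hga : g ≠ a) (hgb : g ≠ b)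
    (hgt : g ≠ t) (ht : S t = []) (hg : S g = []) (hb : S b = []) (hs₀ : 1 ≤ s)
    (hs : (S a).length ≤ s) : Exec A qs s (popWord a b t g) S
      (update (update S a (unword (S a)).2) b (unword (S a)).1) := by
  have hlen := length_unword_le (S a)
  refine (Exec.seq (.push _ _ _ ?_) (.seq (exec_readWord hat hga hgt ?_ ?_)
    (exec_move hbt.symm ?_))).of_eq ?_
  all_goals grind [update_apply]

/-- Moves the stack `t` on top of the self-delimiting word on the stack `b`. -/
def extendWord (t b : K) : Prog K := loop t fun x => seq (push b x) (push b true)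

/-- A delimited word grows at its front: `delimit (x :: v)` is `true :: x :: delimit v`, so each
round prolongs the word by one bit. The order is reversed, which `pushWord` compensates by moving
the word first. -/
theorem exec_extendWord (htb : t ≠ b) {v r : List Bool} (hb : S b = delimit v ++ r)
    (hs : 2 * (S t).length + (S b).length ≤ s) : Exec A qs s (extendWord t b) S
      (update (update S t []) b (delimit ((S t).reverse ++ v) ++ r)) := by
  generalize hu : S t = u
  induction u generalizing S v with
  | nil => exact (Exec.loop_nil hu).of_eq (by grind [update_apply])
  | cons x u ih =>
    have hx : delimit (x :: v) = true :: x :: delimit v := by simp [delimit]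
    rw [hu, List.length_cons] at hs
    refine (Exec.loop_cons (T := update (update S t u) b (true :: x :: S b)) hu
      ((Exec.seq (.push _ _ _ ?_) (.push _ _ _ ?_)).of_eq ?_) (ih (v := x :: v) ?_ ?_ ?_)).of_eq ?_
    all_goals grind [update_apply]

/-- Moves the stack `a` to the stack `b` as a self-delimiting word. -/
def pushWord (a b t : K) : Prog K := seq (push b false) (seq (move a t) (extendWord t b))

theorem exec_pushWord (hat : a ≠ t) (hbt : b ≠ t) (hab : a ≠ b) (ht : S t = [])
    (hs : 2 * (S a).length + 1 + (S b).length ≤ s) : Exec A qs s (pushWord a b t) S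
      (update (update S a []) b (delimit (S a) ++ S b)) := by
  have h₀ : delimit [] = [false] := rfl
  refine (Exec.seq (.push _ _ _ ?_) (.seq (exec_move hat ?_)
    (exec_extendWord hbt.symm (v := []) (r := S b) ?_ ?_))).of_eq ?_
  all_goals grind [update_apply]

/-- Removes a mark from the stack `f`. -/
def unset (f : K) : Prog K := pop f fun _ => skip

theorem exec_unset : Exec A qs s (unset f) S (update S f (S f).tail) := .pop (.skip _)

/-- Unless the stack `a` is a prefix of `b`, removes a mark from the stack `f`. -/
def testPrefix (a b f : K) : Prog K := loop a fun x => pop b fun y => if y = some x then skip else unset f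

/-- The condition on `f` says that there is at most one mark, so removing it once empties the stack
and removing it again does no harm. -/
theorem exec_testPrefix (hab : a ≠ b) (hfa : f ≠ a) (hfb : f ≠ b) (hf : (S f).tail = []) :
    Exec A qs s (testPrefix a b f) S (update (update (update S a []) b ((S b).drop (S a).length)) f
      (if S a <+: S b then S f else [])) := by
  generalize hu : S a = u
  induction u generalizing S with
  | nil => exact (Exec.loop_nil hu).of_eq (by grind [update_apply])
  | cons x u ih =>
    by_cases hx : (S b).head? = some x
    · obtain ⟨v, hv⟩ : ∃ v, S b = x :: v := by
        cases h : S b <;> simp_all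
      refine (Exec.loop_cons (T := update (update S a u) b v) hu (.pop ?_) (ih ?_ ?_)).of_eq ?_
      · rw [update_of_ne hab.symm, if_pos hx]
        exact (Exec.skip _).of_eq (by simp [hv])
      · grind [update_apply]
      · grind [update_apply]
      · rw [update_self, hv]
        simp only [List.cons_prefix_cons, List.length_cons, List.drop_succ_cons]
        grind [update_apply]
    · have hp : ¬ (x :: u) <+: S b := by
        rintro ⟨r, hr⟩
        simp [← hr] at hx
      have hd : (S b).tail.drop u.length = (S b).drop (u.length + 1) := by simp
      refine (Exec.loop_cons (T := update (update (update S a u) b (S b).tail) f []) hu (.pop ?_)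
        (ih ?_ ?_)).of_eq ?_
      · rw [update_of_ne hab.symm, if_neg hx]
        exact exec_unset.of_eq (by grind [update_apply])
      all_goals grind [update_apply]

/-- Compares the stacks `a` and `b`, which are erased, and puts the result on the stack `f`. -/
def testEq (a b f : K) : Prog K :=
  seq (push f true) <| seq (testPrefix a b f) <| pop b fun
    | none => skip
    | some _ => seq (clear f) (clear b)

theorem exec_testEq (hab : a ≠ b) (hfa : f ≠ a) (hfb : f ≠ b) (hf : S f = []) (hs : 1 ≤ s) :
    Exec A qs s (testEq a b f) S
      (update (update (update S a []) b []) f (if S a = S b then [true] else [])) := by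
  refine .seq (T := update S f [true]) ((Exec.push _ _ _ ?_).of_eq ?_) (.seq (exec_testPrefix hab hfa hfb ?_) (.pop ?_))
  · grind
  · grind [update_apply]
  · grind [update_apply]
  · have h : ∀ {x y : List Bool}, x <+: y → y.drop x.length = [] → x = y := by
      rintro x _ ⟨r, rfl⟩ h
      simp at h
      simp [h]
    have hb : update (update (update (update S f [true]) a []) b
        ((update S f [true] b).drop (update S f [true] a).length)) f
        (if update S f [true] a <+: update S f [true] b then update S f [true] f else []) b =
        (S b).drop (S a).length := by grind [update_apply]
    rw [hb]
    cases hd : (S b).drop (S a).length with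
    | nil =>
      refine (Exec.skip _).of_eq ?_
      grind [update_apply, List.prefix_refl]
    | cons x u =>
      refine (Exec.seq exec_clear exec_clear).of_eq ?_
      have : S a ≠ S b := by
        rintro h
        simp [h] at hd
      grind [update_apply]

/-- Runs `body` for each of the self-delimiting words on the stack `a`, with this word on the
stack `w`. -/
def forWords (a w t g : K) (body : Prog K) : Prog K :=
  -- A loop tests for emptiness by popping; the bit goes back before a word is read.
  loop a fun x => seq (push a x) (seq (popWord a w t g) body)

/-- The stores are those of a family `V` with arbitrary contents of `a`; the body acts as `φ` on the
parameter of the family, while `I`, for the list of the words to come, is an invariant. -/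
theorem exec_forWords {α : Type*} (V : α → K → List Bool) (φ : α → List Bool → α)
    (I : List (List Bool) → α → Prop) {body : Prog K} (hat : a ≠ t) (hwt : w ≠ t) (haw : a ≠ w)
    (hga : g ≠ a) (hgw : g ≠ w) (hgt : g ≠ t) (hs₀ : 1 ≤ s) {m : ℕ} (hm : m ≤ s)
    (ht : ∀ z, V z t = []) (hg : ∀ z, V z g = []) (hw : ∀ z, V z w = [])
    (hbody : ∀ u us z x, I (u :: us) z → u.length ≤ m → x.length ≤ m → I us (φ z u) ∧
      Exec A qs s body (update (update (V z) a x) w u) (update (V (φ z u)) a x))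
    {x : List Bool} {z : α} (hx : x.length ≤ m) (hI : I (words x) z) :
    I [] ((words x).foldl φ z) ∧ Exec A qs s (forWords a w t g body) (update (V z) a x)
      (update (V ((words x).foldl φ z)) a []) := by
  induction h : x.length using Nat.strong_induction_on generalizing x z with
  | _ n ih =>
    cases x with
    | nil =>
      rw [words_nil] at hI ⊢
      exact ⟨hI, Exec.loop_nil (by simp)⟩
    | cons b x =>
      have hne : b :: x ≠ [] := by simp
      have h₁ := length_unword_snd_lt hne
      have h₂ := length_unword_le (b :: x)
      rw [words_of_ne_nil hne] at hI ⊢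
      obtain ⟨hI', hb⟩ := hbody _ _ z (unword (b :: x)).2 hI (by omega) (by omega)
      obtain ⟨hI'', hr⟩ := ih _ (h ▸ h₁) (by omega) hI' rfl
      refine ⟨hI'', .loop_cons (b := b) (w := x) (by simp) ((Exec.seq (.push _ _ _ ?_)
        (.seq (exec_popWord hat hwt haw hga hgw hgt ?_ ?_ ?_ hs₀ ?_) ?_))) hr⟩
      · simp only [List.length_cons] at hx
        simp only [update_self]
        omega
      · grind [update_apply]
      · grind [update_apply]
      · grind [update_apply]
      · simp only [update_self, List.length_cons] at *
        omega
      · simpa using hb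

end Prog

/-! ### The program for `allJust` -/

namespace Prog

open Function

theorem Exec.pop_nil {K : Type} [DecidableEq K] {A : Set (List Bool)} {qs k : K} {s : ℕ}
    {S T : K → List Bool} {p : Option Bool → Prog K} (hk : S k = [])
    (h : Exec A qs s (p none) S T) : Exec A qs s (.pop k p) S T := by
  refine .pop ?_
  rw [hk, List.head?_nil, List.tail_nil, ← hk, update_eq_self]
  exact h

theorem Exec.pop_cons {K : Type} [DecidableEq K] {A : Set (List Bool)} {qs k : K} {s : ℕ}
    {S T : K → List Bool} {p : Option Bool → Prog K} {b : Bool} {w : List Bool} (hk : S k = b :: w)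
    (h : Exec A qs s (p (some b)) (update S k w) T) : Exec A qs s (.pop k p) S T := by
  refine .pop ?_
  rw [hk]
  exact h

/-- The stacks of the program. -/
inductive Reg
  -- Input `inp`, split into the listed sets `lst`, the ontology `ont` and the consequence `con`;
  -- current bit vector `msk` with carry `car`, and the code `sub` of the current set; query `qry`;
  -- verdict `ok`; loop mark `run`; counter `cnt`; test results `flg`, `eqf`, `cmp`. The pairs
  -- `oit`/`sub`, `its`/`itm`, `els`/`elt` and `mem`/`wrd` are the working copies and current words
  -- of the nested traversals; `cpy`, `tmp` and `ctl` are auxiliary.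
  | inp | lst | ont | con | msk | run | ok | sub | cnt | its | itm | flg | els | elt | eqf | mem
  | wrd | cpy | cmp | tmp | ctl | qry | oit | car
  deriving DecidableEq

open Reg

instance : Fintype Reg :=
  Fintype.ofList [inp, lst, ont, con, msk, run, ok, sub, cnt, its, itm, flg, els, elt, eqf, mem,
    wrd, cpy, cmp, tmp, ctl, qry, oit, car] fun k => by cases k <;> decide

variable {A : Set (List Bool)} {s m : ℕ} {S T : Reg → List Bool}

/-- Marks `eqf` if the word `elt` is an entry of the sequence `sub`. -/
def testMem : Prog Reg :=
  seq (copy sub mem tmp) <| forWords mem wrd tmp ctl <|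
    seq (copy elt cpy tmp) <| seq (testEq wrd cpy cmp) <| pop cmp fun
      | some _ => seq (clear eqf) (push eqf true)
      | none => skip

theorem foldl_ite_const {α β : Type*} (p : β → Prop) [DecidablePred p] (c z : α) (l : List β) :
    l.foldl (fun z u => if p u then c else z) z = if ∃ u ∈ l, p u then c else z := by
  induction l generalizing z with
  | nil => simp
  | cons u l ih =>
    simp only [List.foldl_cons, ih, List.mem_cons, exists_eq_or_imp]
    by_cases h₁ : p u <;> by_cases h₂ : ∃ u ∈ l, p u <;> simp only [h₁, h₂, if_true, if_false,
      or_true, or_false]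

theorem exec_testMem (hS : ∀ k ∈ [mem, wrd, cpy, cmp, tmp, ctl, eqf], S k = []) (hs : 1 ≤ s)
    (hm : m ≤ s) (hsub : (S sub).length ≤ m) (helt : (S elt).length ≤ m) :
    Exec A qry s testMem S
      (update S eqf (if S elt ∈ words (S sub) then [true] else [])) := by
  simp only [List.forall_mem_cons] at hS
  obtain ⟨h₁, h₂, h₃, h₄, h₅, h₆, h₇, -⟩ := hS
  have key := exec_forWords (A := A) (qs := qry) (s := s) (m := m) (a := mem) (w := wrd) (t := tmp)
    (g := ctl) (V := fun z => update S eqf z) (φ := fun z u => if u = S elt then [true] else z)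
    (I := fun _ _ => True)
    (body := seq (copy elt cpy tmp) <| seq (testEq wrd cpy cmp) <| pop cmp fun
      | some _ => seq (clear eqf) (push eqf true)
      | none => skip)
    (by decide) (by decide) (by decide) (by decide) (by decide) (by decide) hs hm
    (by simpa) (by simpa) (by simpa) ?_ (x := S sub) (z := []) hsub trivial
  · refine .seq (T := update (update S eqf []) mem (S sub))
      ((exec_copy (by decide) (by decide) (by decide) h₅ (by grind)).of_eq ?_) (key.2.of_eq ?_)
    · grind [update_apply]
    · simp only [foldl_ite_const, exists_eq_right]
      grind [update_apply]
  · intro u us z x _ hu hx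
    refine ⟨trivial, .seq (T := update (update (update (update S eqf z) mem x) wrd u) cpy (S elt))
      ((exec_copy (by decide) (by decide) (by decide) ?_ ?_).of_eq ?_)
      (.seq (T := update (update (update S eqf z) mem x) cmp (if u = S elt then [true] else []))
      ((exec_testEq (by decide) (by decide) (by decide) ?_ hs).of_eq ?_) ?_)⟩
    rotate_right
    · by_cases h : u = S elt
      · refine .pop_cons (b := true) (w := []) ?_ ((Exec.seq exec_clear (.push _ _ _ ?_)).of_eq ?_)
        all_goals grind [update_apply]
      · refine .pop_nil ?_ ((Exec.skip _).of_eq ?_)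
        all_goals grind [update_apply]
    all_goals grind [update_apply]

theorem foldl_ite_tail {α β : Type*} (p : β → Prop) [DecidablePred p] (z : List α) (hz : z.tail = [])
    (l : List β) :
    l.foldl (fun z u => if p u then z else z.tail) z = if ∀ u ∈ l, p u then z else [] := by
  induction l generalizing z with
  | nil => simp
  | cons u l ih =>
    simp only [List.foldl_cons, List.forall_mem_cons]
    by_cases h₁ : p u
    · simp only [h₁, if_true, true_and, ih z hz]
    · simp only [h₁, if_false, false_and, hz, ih [] rfl, ite_self]

/-- Marks `flg` if all entries of the sequence `itm` are entries of the sequence `sub`. -/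
def testSubset : Prog Reg :=
  seq (push flg true) <| seq (copy itm els tmp) <| forWords els elt tmp ctl <|
    seq testMem <| seq (clear elt) <| pop eqf fun
      | some _ => skip
      | none => unset flg

theorem exec_testSubset (hS : ∀ k ∈ [mem, wrd, cpy, cmp, tmp, ctl, eqf, els, elt, flg], S k = [])
    (hs : 1 ≤ s) (hm : m ≤ s) (hsub : (S sub).length ≤ m) (hitm : (S itm).length ≤ m) :
    Exec A qry s testSubset S
      (update S flg (if ∀ u ∈ words (S itm), u ∈ words (S sub) then [true] else [])) := by
  simp only [List.forall_mem_cons] at hS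
  obtain ⟨h₁, h₂, h₃, h₄, h₅, h₆, h₇, h₈, h₉, h₁₀, -⟩ := hS
  have key := exec_forWords (A := A) (qs := qry) (s := s) (m := m) (a := els) (w := elt) (t := tmp)
    (g := ctl) (V := fun z => update S flg z)
    (φ := fun z u => if u ∈ words (S sub) then z else z.tail) (I := fun _ _ => True)
    (body := seq testMem <| seq (clear elt) <| pop eqf fun
      | some _ => skip
      | none => unset flg)
    (by decide) (by decide) (by decide) (by decide) (by decide) (by decide) hs hm
    (by simpa) (by simpa) (by simpa) ?_ (x := S itm) (z := [true]) hitm trivial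
  · refine .seq (T := update S flg [true]) ((Exec.push _ _ _ ?_).of_eq ?_)
      (.seq (T := update (update S flg [true]) els (S itm))
        ((exec_copy (by decide) (by decide) (by decide) ?_ ?_).of_eq ?_) (key.2.of_eq ?_))
    rotate_right
    · rw [foldl_ite_tail _ _ rfl]
      grind [update_apply]
    all_goals grind [update_apply]
  · intro u us z x _ hu hx
    refine ⟨trivial, .seq (exec_testMem ?_ hs hm ?_ ?_) (.seq exec_clear ?_)⟩
    · simp [h₁, h₂, h₃, h₄, h₅, h₆, h₇]
    · grind [update_apply]
    · grind [update_apply]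
    · by_cases h : u ∈ words (S sub)
      · refine .pop_cons (b := true) (w := []) ?_ ((Exec.skip _).of_eq ?_)
        all_goals grind [update_apply]
      · refine .pop_nil ?_ (exec_unset.of_eq ?_)
        all_goals grind [update_apply]

/-- The number of entries of the sequence `l` that are sequences with entries from the sequence
`u` only. -/
def countBelow (l u : List Bool) : ℕ :=
  (words l).countP fun v => decide (∀ a ∈ words v, a ∈ words u)

/-- Counts on `cnt`, but only up to two, the entries of the sequence `lst` that are sequences with
entries from the sequence `sub` only. -/
def count : Prog Reg :=
  seq (copy lst its tmp) <| forWords its itm tmp ctl <|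
    seq testSubset <| seq (clear itm) <| pop flg fun
      | some _ => pop cnt fun
        | none => push cnt true
        | some _ => seq (clear cnt) (seq (push cnt true) (push cnt true))
      | none => skip

/-- The counter saturates at two, since only the cases zero, one and more have to be told apart. -/
theorem foldl_count {β : Type*} (p : β → Prop) [DecidablePred p] (n : ℕ) (l : List β) :
    l.foldl (fun z u => if p u then if z = [] then [true] else [true, true] else z)
      (List.replicate (min 2 n) true) = List.replicate (min 2 (n + l.countP fun u => decide (p u))) true := by
  induction l generalizing n with
  | nil => simp
  | cons u l ih =>
    simp only [List.foldl_cons, List.countP_cons]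
    by_cases h : p u
    · have : (if List.replicate (min 2 n) true = [] then [true] else [true, true]) =
          List.replicate (min 2 (n + 1)) true := by
        rcases n with _ | n
        · rfl
        · have h₁ : min 2 (n + 1 + 1) = 2 := by omega
          rw [h₁, if_neg (by simp)]
          rfl
      simp only [h, if_true, this, ih, decide_true]
      congr 2
      omega
    · simp only [h, if_false, ih, decide_false, Bool.false_eq_true, add_zero]

theorem exec_count (hS : ∀ k ∈ [mem, wrd, cpy, cmp, tmp, ctl, eqf, els, elt, flg, its, itm, cnt],
    S k = []) (hs : 2 ≤ s) (hm : m ≤ s) (hsub : (S sub).length ≤ m) (hlst : (S lst).length ≤ m) :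
    Exec A qry s count S
      (update S cnt (List.replicate (min 2 (countBelow (S lst) (S sub))) true)) := by
  simp only [List.forall_mem_cons] at hS
  obtain ⟨h₁, h₂, h₃, h₄, h₅, h₆, h₇, h₈, h₉, h₁₀, h₁₁, h₁₂, h₁₃, -⟩ := hS
  have key := exec_forWords (A := A) (qs := qry) (s := s) (m := m) (a := its) (w := itm) (t := tmp)
    (g := ctl) (V := fun z => update S cnt z)
    (φ := fun z u => if ∀ a ∈ words u, a ∈ words (S sub) then
      if z = [] then [true] else [true, true] else z)
    (I := fun _ _ => True)
    (body := seq testSubset <| seq (clear itm) <| pop flg fun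
      | some _ => pop cnt fun
        | none => push cnt true
        | some _ => seq (clear cnt) (seq (push cnt true) (push cnt true))
      | none => skip)
    (by decide) (by decide) (by decide) (by decide) (by decide) (by decide) (by omega) hm
    (by simpa) (by simpa) (by simpa) ?_ (x := S lst) (z := []) hlst trivial
  · refine .seq (T := update (update S cnt []) its (S lst))
        ((exec_copy (by decide) (by decide) (by decide) ?_ ?_).of_eq ?_) (key.2.of_eq ?_)
    rotate_right
    · have := foldl_count (fun u => ∀ a ∈ words u, a ∈ words (S sub)) 0 (words (S lst))
      simp only [Nat.min_zero, List.replicate_zero, zero_add] at this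
      rw [this]
      intro k
      simp only [countBelow]
      grind [update_apply]
    all_goals grind [update_apply]
  · intro u us z x _ hu hx
    refine ⟨trivial, .seq (exec_testSubset (m := m) ?_ (by omega) hm ?_ ?_)
      (.seq (T := update (update (update S cnt z) its x) flg
        (if ∀ a ∈ words u, a ∈ words (S sub) then [true] else [])) (exec_clear.of_eq ?_) ?_)⟩
    · simp [h₁, h₂, h₃, h₄, h₅, h₆, h₇, h₈, h₉, h₁₀]
    · grind [update_apply]
    · grind [update_apply]
    · have e₁ : update (update (update S cnt z) its x) itm u itm = u := by simp
      have e₂ : update (update (update S cnt z) its x) itm u sub = S sub := by simp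
      rw [e₁, e₂]
      grind [update_apply]
    · by_cases h : ∀ a ∈ words u, a ∈ words (S sub)
      · simp only [if_pos h]
        refine .pop_cons (b := true) (w := []) (by simp) ?_
        cases z with
        | nil =>
          refine .pop_nil ?_ ((Exec.push _ _ _ ?_).of_eq ?_)
          all_goals grind [update_apply]
        | cons b z =>
          refine .pop_cons (b := b) (w := z) ?_ ((Exec.seq exec_clear (.seq (.push _ _ _ ?_)
            (.push _ _ _ ?_))).of_eq ?_)
          all_goals grind [update_apply]
      · simp only [if_neg h]
        refine .pop_nil (by simp) ((Exec.skip _).of_eq ?_)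
        grind [update_apply]

/-- Removes the mark on `ok` if the entries of the sequence `lst` do not form an antichain. -/
def testAntichain : Prog Reg :=
  seq (copy lst oit tmp) <| forWords oit sub tmp ctl <|
    seq count <| seq (clear sub) <| pop cnt fun
      | none => unset ok
      | some _ => pop cnt fun
        | none => skip
        | some _ => unset ok

/-- A listed set is always counted below itself, so the count is one exactly when no other entry of
the list lies below it. -/
theorem exec_testAntichain (hS : ∀ k ∈ [mem, wrd, cpy, cmp, tmp, ctl, eqf, els, elt, flg, its, itm,
    cnt, oit, sub], S k = []) (hok : S ok = [true]) (hs : 2 ≤ s) (hm : m ≤ s)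
    (hlst : (S lst).length ≤ m) :
    Exec A qry s testAntichain S
      (update S ok (if ∀ u ∈ words (S lst), countBelow (S lst) u = 1 then [true] else [])) := by
  simp only [List.forall_mem_cons] at hS
  obtain ⟨h₁, h₂, h₃, h₄, h₅, h₆, h₇, h₈, h₉, h₁₀, h₁₁, h₁₂, h₁₃, h₁₄, h₁₅, -⟩ := hS
  have key := exec_forWords (A := A) (qs := qry) (s := s) (m := m) (a := oit) (w := sub) (t := tmp)
    (g := ctl) (V := fun z => update S ok z)
    (φ := fun z u => if countBelow (S lst) u = 1 then z else z.tail) (I := fun _ _ => True)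
    (body := seq count <| seq (clear sub) <| pop cnt fun
      | none => unset ok
      | some _ => pop cnt fun
        | none => skip
        | some _ => unset ok)
    (by decide) (by decide) (by decide) (by decide) (by decide) (by decide) (by omega) hm
    (by simpa) (by simpa) (by simpa) ?_ (x := S lst) (z := [true]) hlst trivial
  · refine .seq (T := update (update S ok [true]) oit (S lst))
        ((exec_copy (by decide) (by decide) (by decide) ?_ ?_).of_eq ?_) (key.2.of_eq ?_)
    rotate_right
    · rw [foldl_ite_tail _ _ rfl]
      grind [update_apply]
    all_goals grind [update_apply]
  · intro u us z x _ hu hx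
    refine ⟨trivial, .seq (exec_count (m := m) ?_ hs hm ?_ ?_) (.seq exec_clear ?_)⟩
    · simp [h₁, h₂, h₃, h₄, h₅, h₆, h₇, h₈, h₉, h₁₀, h₁₁, h₁₂, h₁₃]
    · grind [update_apply]
    · grind [update_apply]
    · have e₁ : update (update (update S ok z) oit x) sub u lst = S lst := by simp
      have e₂ : update (update (update S ok z) oit x) sub u sub = u := by simp
      rw [e₁, e₂]
      rcases hn : countBelow (S lst) u with _ | _ | n
      · refine .pop_nil ?_ (exec_unset.of_eq ?_)
        all_goals simp only [zero_ne_one, if_false, Nat.min_zero, List.replicate_zero]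
        all_goals grind [update_apply]
      · refine .pop_cons (b := true) (w := []) ?_ (.pop_nil ?_ ((Exec.skip _).of_eq ?_))
        all_goals simp only [zero_add, if_true, show min 2 1 = 1 from rfl, List.replicate_one]
        all_goals grind [update_apply]
      · have h2 : min 2 (n + 1 + 1) = 2 := by omega
        have h3 : n + 1 + 1 ≠ 1 := by omega
        refine .pop_cons (b := true) (w := [true]) ?_ (.pop_cons (b := true) (w := []) ?_
          (exec_unset.of_eq ?_))
        all_goals simp only [h2, h3, if_false, List.replicate]
        all_goals grind [update_apply]

end Prog

/-! ### Enumeration of bit vectors -/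

/-- The number with the binary digits `w`, the least significant one first. -/
def bitsValue : List Bool → ℕ
  | [] => 0
  | b :: w => b.toNat + 2 * bitsValue w

/-- Adds a carry to a binary number; the result is the final carry and the sum. -/
def addCarry : Bool → List Bool → Bool × List Bool
  | c, [] => (c, [])
  | c, b :: w => ((addCarry (c && b) w).1, (c ^^ b) :: (addCarry (c && b) w).2)

theorem length_addCarry (c : Bool) (w : List Bool) : (addCarry c w).2.length = w.length := by
  induction w generalizing c with
  | nil => rfl
  | cons b w ih => simp [addCarry, ih]

/-- The final carry is worth `2 ^ w.length`. An increment therefore either overflows at the last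
vector or raises the value by exactly one. -/
theorem bitsValue_addCarry (c : Bool) (w : List Bool) :
    bitsValue (addCarry c w).2 + (addCarry c w).1.toNat * 2 ^ w.length =
      bitsValue w + c.toNat := by
  induction w generalizing c with
  | nil => simp [addCarry, bitsValue]
  | cons b w ih =>
    have := ih (c && b)
    simp only [addCarry, bitsValue, List.length_cons, pow_succ, ← mul_assoc]
    cases c <;> cases b <;> simp at this ⊢ <;> omega

theorem bitsValue_lt (w : List Bool) : bitsValue w < 2 ^ w.length := by
  induction w with
  | nil => simp [bitsValue]
  | cons b w ih =>
    simp only [bitsValue, List.length_cons, pow_succ]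
    cases b <;> simp <;> omega

theorem bitsValue_injective {v w : List Bool} (hl : v.length = w.length)
    (h : bitsValue v = bitsValue w) : v = w := by
  induction v generalizing w with
  | nil => exact (List.length_eq_zero_iff.1 hl.symm).symm
  | cons b v ih =>
    cases w with
    | nil => simp at hl
    | cons c w =>
      simp only [bitsValue] at h
      simp only [List.length_cons, add_left_inj] at hl
      have hbc : b = c := by cases b <;> cases c <;> simp at h ⊢ <;> omega
      subst hbc
      rw [ih hl (by omega)]

theorem bitsValue_replicate_false (n : ℕ) : bitsValue (List.replicate n false) = 0 := by
  induction n with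
  | zero => rfl
  | succ n ih => simp [List.replicate_succ, bitsValue, ih]

/-- One step of the selection of the entries of a list that are marked in a bit vector. -/
def selectStep (z : List Bool × List (List Bool)) (u : List Bool) : List Bool × List (List Bool) :=
  (z.1.tail, if z.1.head? = some true then u :: z.2 else z.2)

/-- The entries of the list `us` that are marked in the bit vector `y`, in reversed order. -/
def select (y : List Bool) (us : List (List Bool)) : List (List Bool) :=
  (us.foldl selectStep (y, [])).2

namespace Prog

open Function Reg

variable {A : Set (List Bool)} {s m : ℕ} {S T : Reg → List Bool}

/-- Increments the binary number on `msk`, and puts a mark on `car` in case of overflow. -/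
def increment : Prog Reg :=
  seq (push car true) <| seq
    (loop msk fun b => pop car fun
      | some _ => if b then seq (push its false) (push car true) else push its true
      | none => push its b)
    (move its msk)

theorem exec_increment (hcar : S car = []) (hits : S its = []) (hs : 1 ≤ s)
    (hmsk : (S msk).length ≤ s) : Exec A qry s increment S
      (update (update S msk (addCarry true (S msk)).2) car
        (if (addCarry true (S msk)).1 then [true] else [])) := by
  have key : ∀ (w : List Bool) (c : Bool) (S : Reg → List Bool), S msk = w →
      S car = (if c then [true] else []) → w.length + (S its).length ≤ s → Exec A qry s
        (loop msk fun b => pop car fun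
          | some _ => if b then seq (push its false) (push car true) else push its true
          | none => push its b) S
        (update (update (update S msk []) its ((addCarry c w).2.reverse ++ S its)) car
          (if (addCarry c w).1 then [true] else [])) := by
    intro w
    induction w with
    | nil =>
      intro c S hw hc _
      exact (Exec.loop_nil hw).of_eq (by grind [update_apply, addCarry])
    | cons b w ih =>
      intro c S hw hc hl
      rw [List.length_cons] at hl
      refine (Exec.loop_cons (T := update (update (update S msk w) its ((c ^^ b) :: S its)) car
        (if c && b then [true] else [])) hw ?_ (ih (c && b) _ ?_ ?_ ?_)).of_eq ?_
      · cases c with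
        | true =>
          refine .pop_cons (b := true) (w := []) (by simpa using hc) ?_
          cases b with
          | true =>
            refine (Exec.seq (.push _ _ _ ?_) (.push _ _ _ ?_)).of_eq ?_
            all_goals grind [update_apply]
          | false =>
            refine (Exec.push _ _ _ ?_).of_eq ?_
            all_goals grind [update_apply]
        | false =>
          have hb : (false ^^ b) = b := by cases b <;> rfl
          rw [hb]
          refine .pop_nil (by simpa using hc) ?_
          refine (Exec.push _ _ _ ?_).of_eq ?_
          all_goals grind [update_apply]
      all_goals grind [update_apply, addCarry]
  have hl := length_addCarry true (S msk)
  refine .seq (T := update S car [true]) ((Exec.push _ _ _ ?_).of_eq ?_)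
    (.seq (T := update (update (update S msk []) its (addCarry true (S msk)).2.reverse) car
      (if (addCarry true (S msk)).1 then [true] else []))
      ((key (S msk) true _ ?_ ?_ ?_).of_eq ?_) ((exec_move (by decide) ?_).of_eq ?_))
  all_goals grind [update_apply]

/-- Puts on `sub` the sequence of the entries of `ont` that are marked in the bit vector `msk`. -/
def selectMarked : Prog Reg :=
  seq (copy ont els tmp) <| seq (copy msk its tmp) <| seq
    (forWords els elt tmp ctl <| pop its fun
      | some true => pushWord elt sub tmp
      | _ => clear elt)
    (clear its)

theorem exec_selectMarked (hS : ∀ k ∈ [tmp, ctl, els, elt, its, sub], S k = []) (hs₁ : 1 ≤ s)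
    (hont : 2 * (S ont).length ≤ s) (hmsk : (S msk).length ≤ s) :
    (seqCode (select (S msk) (words (S ont)))).length ≤ 2 * (S ont).length ∧
    Exec A qry s selectMarked S (update S sub (seqCode (select (S msk) (words (S ont))))) := by
  simp only [List.forall_mem_cons] at hS
  obtain ⟨h₁, h₂, h₃, h₄, h₅, h₆, -⟩ := hS
  have hcons : ∀ u us, seqCode (u :: us) = delimit u ++ seqCode us := by simp [seqCode]
  have key := exec_forWords (A := A) (qs := qry) (s := s) (m := (S ont).length) (a := els) (w := elt)
    (t := tmp) (g := ctl) (V := fun z => update (update S its z.1) sub (seqCode z.2))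
    (φ := selectStep)
    -- Each word moves from the remaining ones to the selected ones or is dropped, so the total code
    -- length never grows. Initially it is at most twice the input by `length_seqCode_words_le`.
    (I := fun us z => (seqCode us).length + (seqCode z.2).length ≤ 2 * (S ont).length)
    (body := pop its fun
      | some true => pushWord elt sub tmp
      | _ => clear elt)
    (by decide) (by decide) (by decide) (by decide) (by decide) (by decide) hs₁ (by omega)
    (by simpa) (by simpa) (by simpa) ?_ (x := S ont) (z := (S msk, [])) le_rfl
    (by simpa [seqCode] using length_seqCode_words_le (S ont))
  · have hnil : seqCode [] = [] := rfl
    obtain ⟨k₁, k₂⟩ := key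
    simp only [hnil, List.length_nil, zero_add] at k₁ k₂
    unfold select
    generalize List.foldl selectStep (S msk, []) (words (S ont)) = z at k₁ k₂ ⊢
    generalize seqCode z.2 = N at k₁ k₂ ⊢
    refine ⟨k₁, ?_⟩
    refine .seq (T := update S els (S ont))
      ((exec_copy (by decide) (by decide) (by decide) ?_ ?_).of_eq ?_)
      (.seq (T := update (update (update S its (S msk)) sub []) els (S ont))
        ((exec_copy (by decide) (by decide) (by decide) ?_ ?_).of_eq ?_)
        (.seq k₂ (exec_clear.of_eq ?_)))
    all_goals grind [update_apply]
  · rintro u us ⟨y, l⟩ x hI hu hx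
    simp only [hcons, List.length_append] at hI
    have hd := length_delimit u
    rcases y with _ | ⟨_ | _, y⟩
    · simp only [selectStep, List.head?_nil, List.tail_nil, reduceCtorEq, if_false]
      refine ⟨by omega, .pop_nil ?_ (exec_clear.of_eq ?_)⟩
      all_goals grind [update_apply]
    · simp only [selectStep, List.head?_cons, List.tail_cons, Option.some.injEq,
        Bool.false_eq_true, if_false]
      refine ⟨by omega, .pop_cons (b := false) (w := y) ?_ (exec_clear.of_eq ?_)⟩
      all_goals grind [update_apply]
    · simp only [selectStep, List.head?_cons, List.tail_cons, if_true, hcons, List.length_append]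
      refine ⟨by omega, .pop_cons (b := true) (w := y) ?_
        ((exec_pushWord (by decide) (by decide) (by decide) ?_ ?_).of_eq ?_)⟩
      all_goals grind [update_apply]

/-- On the sub-ontology marked in the bit vector `y`, the oracle agrees with the listed sets. -/
def agrees (A : Set (List Bool)) (l o c y : List Bool) : Prop :=
  seqCode [seqCode (select y (words o)), c] ∈ A ↔
    0 < countBelow l (seqCode (select y (words o)))

/-- Removes the mark on `ok` if the oracle does not agree with the listed sets on the sub-ontology
marked in the bit vector `msk`. -/
def testAgrees : Prog Reg :=
  seq selectMarked <| seq count <| seq (copy con elt tmp) <| seq (pushWord elt qry tmp) <|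
    seq (pushWord sub qry tmp) <| query fun ans => pop cnt fun o =>
      seq (clear cnt) (if o.isSome = ans then skip else unset ok)

-- The query determines the space: the selected set `N` has a code of length at most `2 * n`, hence
-- `4 * n + 1` when delimited, and the delimited consequence takes `2 * n + 1`. Together this is `6
-- * n + 2`.
open Classical in
theorem exec_testAgrees (hS : ∀ k ∈ [mem, wrd, cpy, cmp, tmp, ctl, eqf, els, elt, flg, its, itm,
    cnt, sub, qry], S k = []) {n : ℕ} (hs : s = 6 * n + 2) (hlst : (S lst).length ≤ n)
    (hont : (S ont).length ≤ n) (hcon : (S con).length ≤ n) (hmsk : (S msk).length ≤ n)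
    (hok : (S ok).tail = []) : Exec A qry s testAgrees S
      (update S ok (if agrees A (S lst) (S ont) (S con) (S msk) then S ok else [])) := by
  simp only [List.forall_mem_cons] at hS
  obtain ⟨h₁, h₂, h₃, h₄, h₅, h₆, h₇, h₈, h₉, h₁₀, h₁₁, h₁₂, h₁₃, h₁₄, h₁₅, -⟩ := hS
  obtain ⟨hlen, hsel⟩ := exec_selectMarked (A := A) (s := s) (S := S) (by simp [*]) (by omega)
    (by omega) (by omega)
  unfold agrees
  generalize seqCode (select (S msk) (words (S ont))) = N at hlen hsel ⊢
  have e₁ : update S sub N lst = S lst := by simp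
  have e₂ : update S sub N sub = N := by simp
  have hcnt := exec_count (A := A) (s := s) (m := 2 * n) (S := update S sub N) (by simp [*]) (by omega)
    (by omega) (by rw [e₂]; omega) (by rw [e₁]; omega)
  rw [e₁, e₂] at hcnt
  generalize countBelow (S lst) N = i at hcnt ⊢
  have hcl := length_delimit (S con)
  have hseq : delimit N ++ delimit (S con) = seqCode [N, S con] := by simp [seqCode]
  refine .seq hsel (.seq hcnt (.seq
    (T := update (update (update S sub N) cnt (List.replicate (min 2 i) true)) elt (S con))
      ((exec_copy (by decide) (by decide) (by decide) ?_ ?_).of_eq ?_) (.seq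
    (T := update (update (update S sub N) cnt (List.replicate (min 2 i) true)) qry (delimit (S con)))
      ((exec_pushWord (by decide) (by decide) (by decide) ?_ ?_).of_eq ?_) (.seq
    (T := update (update S cnt (List.replicate (min 2 i) true)) qry (seqCode [N, S con]))
      ((exec_pushWord (by decide) (by decide) (by decide) ?_ ?_).of_eq ?_) (.query ?_)))))
  rotate_right
  · rw [update_self, update_idem, ← h₁₅, update_comm (by decide), update_eq_self]
    refine .pop (.seq exec_clear ?_)
    have e₃ : update S cnt (List.replicate (min 2 i) true) cnt = List.replicate (min 2 i) true :=
      update_self ..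
    have e₄ : (List.replicate (min 2 i) true).head?.isSome = decide (0 < i) := by
      rcases i with _ | i
      · rfl
      · have : min 2 (i + 1) = min 1 i + 1 := by omega
        simp [this, List.replicate_succ]
    simp only [e₃, e₄, update_idem]
    rw [← h₁₃, update_eq_self]
    by_cases h : seqCode [N, S con] ∈ A ↔ 0 < i
    · rw [if_pos (by simpa using h.symm), if_pos h, update_eq_self]
      exact .skip _
    · rw [if_neg (by simpa using fun h' => h h'.symm), if_neg h]
      exact exec_unset.of_eq fun _ => by rw [hok, h₁₅]
  all_goals grind [update_apply]

end Prog

/-! ### Running through all bit vectors, and the complete program -/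

namespace Prog

open Function Reg

variable {A : Set (List Bool)} {s m : ℕ} {S T : Reg → List Bool}

/-- Runs `testAgrees` for the bit vectors from `msk` on. -/
def enumerate : Prog Reg :=
  loop run fun _ => seq testAgrees <| seq increment <| pop car fun
    | some _ => skip
    | none => push run true

-- Induction on the number of vectors from the current one to the end. Only the verdict on `ok` is
-- specified, because the other stacks no longer matter.
open Classical in
theorem exec_enumerate {n : ℕ} (hs : s = 6 * n + 2)
    (hS : ∀ k ∈ [mem, wrd, cpy, cmp, tmp, ctl, eqf, els, elt, flg, its, itm, cnt, sub, qry, car],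
      S k = []) (hrun : S run = [true]) (hlst : (S lst).length ≤ n)
    (hont : (S ont).length ≤ n) (hcon : (S con).length ≤ n) (hmsk : (S msk).length ≤ n)
    (hok : (S ok).tail = []) : ∃ T, Exec A qry s enumerate S T ∧
      T ok = if ∀ y : List Bool, y.length = (S msk).length → bitsValue (S msk) ≤ bitsValue y →
        agrees A (S lst) (S ont) (S con) y then S ok else [] := by
  induction h : 2 ^ (S msk).length - bitsValue (S msk) using Nat.strong_induction_on
    generalizing S with
  | _ i ih =>
    have hS' := hS
    simp only [List.forall_mem_cons] at hS'
    obtain ⟨h₁, h₂, h₃, h₄, h₅, h₆, h₇, h₈, h₉, h₁₀, h₁₁, h₁₂, h₁₃, h₁₄, h₁₅, h₁₆, -⟩ := hS'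
    have hval := bitsValue_addCarry true (S msk)
    have hlen := length_addCarry true (S msk)
    have hlt := bitsValue_lt (S msk)
    set y₀ := S msk with hy₀
    set z := if agrees A (S lst) (S ont) (S con) y₀ then S ok else [] with hz
    have hztail : z.tail = [] := by
      rw [hz]; split_ifs
      · exact hok
      · rfl
    have hagr : Exec A qry s testAgrees (update S run []) (update (update S run []) ok z) :=
      exec_testAgrees (n := n) (by simp [*]) hs (by simpa) (by simpa) (by simpa) (by simpa)
        (by simpa)
    have hms : update (update S run []) ok z msk = y₀ := by simp [hy₀]
    have hinc : Exec A qry s increment (update (update S run []) ok z)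
        (update (update (update (update S run []) ok z) msk (addCarry true y₀).2) car
          (if (addCarry true y₀).1 then [true] else [])) :=
      hms ▸ exec_increment (S := update (update S run []) ok z) (by simp [*]) (by simp [*])
        (by omega) (by rw [hms]; omega)
    cases hc : (addCarry true y₀).1 with
    | true =>
      rw [hc] at hinc hval
      refine ⟨update (update (update S run []) ok z) msk (addCarry true y₀).2,
        .loop_cons hrun (.seq hagr (.seq hinc (.pop_cons (b := true) (w := []) (by simp)
          ((Exec.skip _).of_eq (by grind [update_apply]))))) (.loop_nil (by simp)), ?_⟩
      have hz' : update (update (update S run []) ok z) msk (addCarry true y₀).2 ok = z := by simp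
      rw [hz', hz]
      -- Overflow means that `y₀` has the largest value of its length, so it is the only vector
      -- left.
      refine if_congr ⟨fun h y hy hle => ?_, fun h => h _ rfl le_rfl⟩ rfl rfl
      have := bitsValue_lt y
      rw [hy] at this
      simp only [Bool.toNat_true, one_mul] at hval
      rw [bitsValue_injective hy (by omega)]
      exact h
    | false =>
      rw [hc] at hinc hval
      simp only [Bool.toNat_true, Bool.toNat_false, zero_mul, add_zero] at hval
      have hlt' := bitsValue_lt (addCarry true y₀).2
      rw [hlen] at hlt'
      let S' := update (update S ok z) msk (addCarry true y₀).2
      have e₁ : S' msk = (addCarry true y₀).2 := by simp [S']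
      have e₂ : S' ok = z := by simp [S']
      have e₃ : ∀ k, k ≠ msk → k ≠ ok → S' k = S k := fun k h h' => by simp [S', h, h']
      obtain ⟨T, hT, hTok⟩ := ih (2 ^ y₀.length - bitsValue (addCarry true y₀).2)
        (by omega) (S := S')
        (by simpa [S'] using hS) (by simpa [S'] using hrun) (by simpa [S'] using hlst)
        (by simpa [S'] using hont) (by simpa [S'] using hcon) (by rw [e₁]; omega) (by rwa [e₂])
        (by rw [e₁, hlen])
      refine ⟨T, .loop_cons (T := S') hrun (.seq hagr (.seq hinc (.pop_nil (by simp)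
        ((Exec.push _ _ _ ?_).of_eq ?_)))) hT, ?_⟩
      · simp only [update_self, update_of_ne, ne_eq, reduceCtorEq, not_false_eq_true,
          List.length_nil]
        omega
      · grind [update_apply]
      · rw [hTok, e₁, e₂, e₃ lst (by decide) (by decide), e₃ ont (by decide) (by decide),
          e₃ con (by decide) (by decide), hlen]
        by_cases h₀ : agrees A (S lst) (S ont) (S con) y₀
        · rw [hz, if_pos h₀]
          refine if_congr ⟨fun h y hy hle => ?_, fun h y hy hle => h y hy (by omega)⟩ rfl rfl
          -- A vector not below `y₀` is `y₀` itself or at least its successor.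
          rcases hle.eq_or_lt with heq | hlt''
          · rwa [← bitsValue_injective hy.symm heq]
          · exact h y hy (by omega)
        · rw [hz, if_neg h₀, ite_self, if_neg fun h => h₀ (h _ rfl le_rfl)]

/-- Pushes as many zeros on `msk` as there are bits on `els`, which is erased. -/
def pushZeros : Prog Reg := loop els fun _ => push msk false

theorem exec_pushZeros (hs : (S els).length + (S msk).length ≤ s) : Exec A qry s pushZeros S
    (update (update S els []) msk (List.replicate (S els).length false ++ S msk)) := by
  generalize hw : S els = u
  induction u generalizing S with
  | nil => exact (Exec.loop_nil hw).of_eq (by grind [update_apply])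
  | cons x u ih =>
    rw [hw, List.length_cons] at hs
    have hrep : List.replicate (u.length + 1) false ++ S msk =
        List.replicate u.length false ++ false :: S msk := by
      rw [List.replicate_succ']
      simp
    refine (Exec.loop_cons (p := fun _ => push msk false)
      (T := update (update S els u) msk (false :: S msk)) hw
      ((Exec.push _ _ _ ?_).of_eq ?_)
      (ih (S := update (update S els u) msk (false :: S msk)) ?_ ?_)).of_eq ?_
    all_goals grind [update_apply]

/-- The program for `allJust`. -/
def testAllJust : Prog Reg :=
  seq (popWord inp lst tmp ctl) <| seq (popWord inp ont tmp ctl) <| seq (popWord inp con tmp ctl) <|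
    seq (push ok true) <| seq testAntichain <| seq (copy ont els tmp) <| seq pushZeros <|
    seq (push run true) enumerate

/-- The words that the program for `allJust` accepts. -/
def accepted (A : Set (List Bool)) : Set (List Bool) :=
  {x | (∀ u ∈ words (unword x).1, countBelow (unword x).1 u = 1) ∧
    ∀ y : List Bool, y.length = (unword (unword x).2).1.length →
      agrees A (unword x).1 (unword (unword x).2).1 (unword (unword (unword x).2).2).1 y}

theorem exec_testAllJust (x : List Bool) : ∃ T,
    Exec A qry (6 * x.length + 2) testAllJust (update (fun _ => []) inp x) T ∧
      ((T ok).head? = some true ↔ x ∈ accepted A) := by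
  classical
  generalize hs : 6 * x.length + 2 = s
  simp only [accepted, Set.mem_ofPred_eq]
  have l₁ := length_unword_le x
  set r₁ := (unword x).2
  have l₂ := length_unword_le r₁
  set r₂ := (unword r₁).2
  have l₃ := length_unword_le r₂
  set r₃ := (unword r₂).2 with hr₃
  set l := (unword x).1 with hl
  set o := (unword r₁).1 with ho
  set c := (unword r₂).1 with hc
  set z := if ∀ u ∈ words l, countBelow l u = 1 then [true] else [] with hz
  have hztail : z.tail = [] := by rw [hz]; split_ifs <;> rfl
  let S₀ : Reg → List Bool := update (fun _ => []) inp x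
  let S₁ := update (update S₀ inp r₁) lst l
  let S₂ := update (update S₁ inp r₂) ont o
  let S₃ := update (update S₂ inp r₃) con c
  let S₄ := update S₃ ok [true]
  let S₅ := update S₄ ok z
  let S₆ := update S₅ els o
  let S₇ := update S₅ msk (List.replicate o.length false)
  let S₈ := update S₇ run [true]
  have h₁ : Exec A qry s (popWord inp lst tmp ctl) S₀ S₁ :=
    (exec_popWord (by decide) (by decide) (by decide) (by decide) (by decide) (by decide)
      (by simp [S₀]) (by simp [S₀]) (by simp [S₀]) (by omega) (by simp [S₀]; omega)).of_eq
        (by simp [S₁, S₀, r₁, l])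
  have h₂ : Exec A qry s (popWord inp ont tmp ctl) S₁ S₂ :=
    (exec_popWord (by decide) (by decide) (by decide) (by decide) (by decide) (by decide)
      (by simp [S₀, S₁]) (by simp [S₀, S₁]) (by simp [S₀, S₁]) (by omega)
      (by simp [S₁]; omega)).of_eq (by
        have : S₁ inp = r₁ := by simp [S₁]
        simp [S₂, this, r₂, o])
  have h₃ : Exec A qry s (popWord inp con tmp ctl) S₂ S₃ :=
    (exec_popWord (by decide) (by decide) (by decide) (by decide) (by decide) (by decide)
      (by simp [S₀, S₁, S₂]) (by simp [S₀, S₁, S₂]) (by simp [S₀, S₁, S₂]) (by omega)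
      (by simp [S₂]; omega)).of_eq (by
        have : S₂ inp = r₂ := by simp [S₂]
        simp [S₃, this, r₃, c])
  have h₄ : Exec A qry s (push ok true) S₃ S₄ :=
    (Exec.push _ _ _ (by simp [S₀, S₁, S₂, S₃]; omega)).of_eq (by simp [S₀, S₁, S₂, S₃, S₄])
  have h₅ : Exec A qry s testAntichain S₄ S₅ :=
    (exec_testAntichain (m := x.length) (by simp [S₀, S₁, S₂, S₃, S₄]) (by simp [S₄]) (by omega)
      (by omega) (by simp [S₁, S₂, S₃, S₄]; omega)).of_eq (by
        have : S₄ lst = l := by simp [S₁, S₂, S₃, S₄]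
        simp [S₅, this, hz])
  have h₆ : Exec A qry s (copy ont els tmp) S₅ S₆ :=
    (exec_copy (by decide) (by decide) (by decide) (by simp [S₀, S₁, S₂, S₃, S₄, S₅])
      (by simp [S₀, S₁, S₂, S₃, S₄, S₅]; omega)).of_eq (by simp [S₀, S₁, S₂, S₃, S₄, S₅, S₆])
  have hels : update S₅ els [] = S₅ := by
    rw [← update_eq_self els S₅, update_idem]
    simp [S₀, S₁, S₂, S₃, S₄, S₅]
  have h₇ : Exec A qry s pushZeros S₆ S₇ :=
    (exec_pushZeros (by simp [S₀, S₁, S₂, S₃, S₄, S₅, S₆]; omega)).of_eq (by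
      have e₁ : S₆ els = o := by simp [S₆]
      have e₂ : S₆ msk = [] := by simp [S₀, S₁, S₂, S₃, S₄, S₅, S₆]
      rw [e₁, e₂, List.append_nil]
      simp [S₆, S₇, hels])
  have h₈ : Exec A qry s (push run true) S₇ S₈ :=
    (Exec.push _ _ _ (by simp [S₀, S₁, S₂, S₃, S₄, S₅, S₇]; omega)).of_eq
      (by simp [S₀, S₁, S₂, S₃, S₄, S₅, S₇, S₈])
  obtain ⟨T, hT, hok⟩ := exec_enumerate (A := A) (S := S₈) hs.symm
    (by simp [S₀, S₁, S₂, S₃, S₄, S₅, S₇, S₈]) (by simp [S₈])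
    (by simp [S₁, S₂, S₃, S₄, S₅, S₇, S₈]; omega) (by simp [S₂, S₃, S₄, S₅, S₇, S₈]; omega)
    (by simp [S₃, S₄, S₅, S₇, S₈]; omega) (by simp [S₇, S₈]; omega)
    (by simpa [S₅, S₇, S₈] using hztail)
  refine ⟨T, .seq h₁ (.seq h₂ (.seq h₃ (.seq h₄ (.seq h₅ (.seq h₆ (.seq h₇ (.seq h₈ hT))))))), ?_⟩
  have e₁ : S₈ msk = List.replicate o.length false := by simp [S₇, S₈]
  have e₂ : S₈ lst = l := by simp [S₁, S₂, S₃, S₄, S₅, S₇, S₈]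
  have e₃ : S₈ ont = o := by simp [S₂, S₃, S₄, S₅, S₇, S₈]
  have e₄ : S₈ con = c := by simp [S₃, S₄, S₅, S₇, S₈]
  have e₅ : S₈ ok = z := by simp [S₅, S₇, S₈]
  rw [e₁, e₂, e₃, e₄, e₅, hz] at hok
  simp only [List.length_replicate, bitsValue_replicate_false, Nat.zero_le, forall_const] at hok
  rw [hok]
  by_cases g₁ : ∀ u ∈ words l, countBelow l u = 1
  · by_cases g₂ : ∀ y : List Bool, y.length = o.length → agrees A l o c y
    · rw [if_pos g₁, if_pos g₂]
      exact iff_of_true rfl ⟨g₁, g₂⟩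
    · rw [if_neg g₂]
      exact iff_of_false (by simp) fun h => g₂ h.2
  · rw [if_neg g₁, ite_self]
    exact iff_of_false (by simp) fun h => g₁ h.1

theorem accepted_mem {C : Set (Set (List Bool))} (hC : PSPACEWithOracle C ⊆ C) (hA : A ∈ C) :
    accepted A ∈ C := by
  refine hC ⟨A, hA, machine testAllJust inp qry ok,
    Polynomial.C (Fintype.card Reg) * (6 * Polynomial.X + 2), ?_⟩
  have := decidesInSpace_machine (A := A) (L := accepted A) (s := fun n => 6 * n + 2)
    (fun n => by omega) (exec_testAllJust (A := A))
  convert! this using 2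
  simp

end Prog

/-! ### Ontology languages -/

/-- The bit vectors have one bit for each bit of the code of the ontology, not for each axiom. This
is enough, and superfluous bits have no effect. -/
theorem length_le_length_seqCode (ws : List (List Bool)) : ws.length ≤ (seqCode ws).length := by
  induction ws with
  | nil => simp
  | cons w ws ih =>
    have : seqCode (w :: ws) = delimit w ++ seqCode ws := by simp [seqCode]
    rw [this, List.length_append, length_delimit, List.length_cons]
    omega

theorem exists_sublist_select (y : List Bool) (us : List (List Bool)) :
    ∃ vs : List (List Bool), vs.Sublist us ∧ select y us = vs.reverse := by
  suffices ∀ (us : List (List Bool)) (y : List Bool) (ts : List (List Bool)),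
      ∃ vs : List (List Bool), vs.Sublist us ∧ (us.foldl selectStep (y, ts)).2 = vs.reverse ++ ts by
    simpa [select] using this us y []
  intro us
  induction us with
  | nil => exact fun y ts => ⟨[], .slnil, rfl⟩
  | cons u us ih =>
    intro y ts
    rw [List.foldl_cons, selectStep]
    by_cases h : y.head? = some true
    · obtain ⟨vs, hvs, h'⟩ := ih y.tail (u :: ts)
      exact ⟨u :: vs, hvs.cons_cons u, by simp [h, h']⟩
    · obtain ⟨vs, hvs, h'⟩ := ih y.tail ts
      exact ⟨vs, hvs.cons u, by simp [h, h']⟩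

/-- The vector has `true` at the entries that are kept, `false` at the others, and `false` as
padding. The reversed order is harmless, since any listing codes a set. -/
theorem exists_select_eq_reverse {us vs : List (List Bool)} (h : vs.Sublist us) {n : ℕ}
    (hn : us.length ≤ n) : ∃ y : List Bool, y.length = n ∧ select y us = vs.reverse := by
  suffices ∃ y : List Bool, y.length = n ∧ ∀ ts : List (List Bool),
      (us.foldl selectStep (y, ts)).2 = vs.reverse ++ ts by
    obtain ⟨y, hy, h⟩ := this
    exact ⟨y, hy, by simpa [select] using h []⟩
  induction h generalizing n with
  | slnil => exact ⟨List.replicate n false, by simp, fun ts => rfl⟩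
  | cons u _ ih =>
    obtain _ | n := n
    · simp at hn
    obtain ⟨y, hy, h⟩ := ih (Nat.le_of_succ_le_succ hn)
    exact ⟨false :: y, by simp [hy], fun ts => by simp [selectStep, h]⟩
  | cons_cons u _ ih =>
    obtain _ | n := n
    · simp at hn
    obtain ⟨y, hy, h⟩ := ih (Nat.le_of_succ_le_succ hn)
    exact ⟨true :: y, by simp [hy], fun ts => by simp [selectStep, h]⟩

theorem List.Forall₂.exists_of_mem {α β : Type*} {R : α → β → Prop} {l : List α} {l' : List β}
    (h : List.Forall₂ R l l') {a : α} (ha : a ∈ l) : ∃ b ∈ l', R a b := by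
  induction h with
  | nil => simp at ha
  | cons hab _ ih =>
    rcases List.mem_cons.1 ha with rfl | ha
    · exact ⟨_, List.mem_cons_self, hab⟩
    · obtain ⟨b, hb, h⟩ := ih ha
      exact ⟨b, List.mem_cons_of_mem _ hb, h⟩

theorem List.Nodup.countP_eq_one_iff {α : Type*} {l : List α} (hl : l.Nodup) {p : α → Bool} {a : α}
    (ha : a ∈ l) (hp : p a) : l.countP p = 1 ↔ ∀ b ∈ l, p b → b = a := by
  rw [List.countP_eq_length_filter, List.length_eq_one_iff]
  have hmem : a ∈ l.filter p := List.mem_filter.2 ⟨ha, hp⟩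
  constructor
  · rintro ⟨x, hx⟩ b hb hpb
    have hb' : b ∈ l.filter p := List.mem_filter.2 ⟨hb, hpb⟩
    rw [hx, List.mem_singleton] at hmem hb'
    rw [hmem, hb']
  · intro h
    refine ⟨a, List.perm_singleton.1 ((List.perm_ext_iff_of_nodup (hl.filter p) (by simp)).2 ?_)⟩
    intro b
    rw [List.mem_singleton, List.mem_filter]
    exact ⟨fun hb => h b hb.1 hb.2, by rintro rfl; exact ⟨ha, hp⟩⟩

/-! ### Justifications as minimal entailing sets, and completeness of `allJust` -/

namespace OntologyLanguage

variable {𝒜 𝒞 : Type*} {𝓛 : OntologyLanguage 𝒜 𝒞} {O M N : Finset 𝒜} {c : 𝒞} {v w : List Bool}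

theorem exists_isJustification (h : 𝓛.Entails O c) : ∃ M, 𝓛.IsJustification O c M := by
  induction O using Finset.strongInduction with
  | _ O ih =>
    by_cases hO : ∃ N ⊂ O, 𝓛.Entails N c
    · obtain ⟨N, hN, hNc⟩ := hO
      obtain ⟨M, hM, hM'⟩ := ih N hN hNc
      exact ⟨M, hM.trans hN.subset, hM'⟩
    · exact ⟨O, subset_rfl, h, fun N hN hNc => hO ⟨N, hN, hNc⟩⟩

/-- The core of the hardness proof: a finite entailing set can be shrunk to a minimal one, and by
monotonicity any justification inside `O` makes `O` entail `c`. -/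
theorem forall_not_isJustification_iff (hO : O ∈ 𝓛.ontologies) :
    (∀ M, ¬ 𝓛.IsJustification O c M) ↔ ¬ 𝓛.Entails O c := by
  rw [← not_exists, not_iff_not]
  exact ⟨fun ⟨M, hM, h, _⟩ => 𝓛.mono M O c (𝓛.mem_of_entails M c h) hO h hM,
    exists_isJustification⟩

/-- Within `O` the entailing sets form an up-set, generated by its minimal elements. Conversely, an
antichain that generates an up-set consists of exactly its minimal elements. -/
theorem forall_mem_iff_isJustification_iff (hO : O ∈ 𝓛.ontologies) {Ms : Finset (Finset 𝒜)}
    (hMs : ∀ M ∈ Ms, M ⊆ O) : (∀ M, M ∈ Ms ↔ 𝓛.IsJustification O c M) ↔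
      (∀ M ∈ Ms, ∀ N ∈ Ms, N ⊆ M → N = M) ∧
        ∀ N ⊆ O, (𝓛.Entails N c ↔ ∃ M ∈ Ms, M ⊆ N) := by
  constructor
  · intro h
    refine ⟨fun M hM N hN hNM => by_contra fun hne => ?_, fun N hN => ⟨fun hc => ?_, ?_⟩⟩
    · exact ((h M).1 hM).2.2 N (hNM.ssubset_of_ne hne) ((h N).1 hN).2.1
    · obtain ⟨M, hM, hM'⟩ := exists_isJustification hc
      exact ⟨M, (h M).2 ⟨hM.trans hN, hM'⟩, hM⟩
    · rintro ⟨M, hM, hMN⟩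
      have hMc := ((h M).1 hM).2.1
      exact 𝓛.mono M N c (𝓛.mem_of_entails M c hMc) (𝓛.subset_mem N O hN hO) hMc hMN
  · rintro ⟨h₁, h₂⟩ M
    have hent : ∀ M ∈ Ms, 𝓛.Entails M c := fun M hM => (h₂ M (hMs M hM)).2 ⟨M, hM, subset_rfl⟩
    refine ⟨fun hM => ⟨hMs M hM, hent M hM, fun N hN hNc => ?_⟩, fun ⟨hM, hMc, hmin⟩ => ?_⟩
    · obtain ⟨M', hM', hM'N⟩ := (h₂ N (hN.subset.trans (hMs M hM))).1 hNc
      have := h₁ M hM M' hM' (hM'N.trans hN.subset)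
      exact hN.not_subset (this ▸ hM'N)
    · obtain ⟨N, hN, hNM⟩ := (h₂ M hM).1 hMc
      rcases hNM.eq_or_ssubset with rfl | hss
      · exact hN
      · exact absurd (hent N hN) (hmin N hss)

theorem codesOntology_iff : 𝓛.CodesOntology w O ↔ ∃ l : List 𝒜, l.Nodup ∧ (∀ a, a ∈ l ↔ a ∈ O) ∧
    w = seqCode (l.map 𝓛.axiomCode.encode) := by
  have key : ∀ (ws : List (List Bool)) (l : List 𝒜),
      List.Forall₂ (fun v a => v = 𝓛.axiomCode.encode a) ws l ↔ ws = l.map 𝓛.axiomCode.encode := by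
    intro ws l
    rw [← List.forall₂_map_right_iff (R := Eq), List.forall₂_eq_eq_eq]
  simp only [CodesOntology, CodesFinset, key]
  constructor
  · rintro ⟨l, ws, h₁, h₂, rfl, h₃⟩
    exact ⟨l, h₁, h₂, h₃⟩
  · rintro ⟨l, h₁, h₂, h₃⟩
    exact ⟨l, _, h₁, h₂, rfl, h₃⟩

theorem CodesOntology.mem_words_iff (h : 𝓛.CodesOntology w O) {u : List Bool} :
    u ∈ words w ↔ ∃ a ∈ O, 𝓛.axiomCode.encode a = u := by
  obtain ⟨l, -, hl, rfl⟩ := codesOntology_iff.1 h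
  simp [words_seqCode, hl]

/-- As the encoding of axioms is injective, inclusion can be tested on codes, whatever the order of
the listings. -/
theorem CodesOntology.forall_mem_words_iff (hM : 𝓛.CodesOntology v M)
    (hN : 𝓛.CodesOntology w N) : (∀ u ∈ words v, u ∈ words w) ↔ M ⊆ N := by
  simp only [hM.mem_words_iff, hN.mem_words_iff, forall_exists_index, and_imp,
    forall_apply_eq_imp_iff₂, 𝓛.axiomCode.encode_injective.eq_iff, exists_eq_right]
  exact Iff.rfl

open Classical in
theorem countBelow_eq {ws : List (List Bool)} {l : List (Finset 𝒜)}
    (h : List.Forall₂ 𝓛.CodesOntology ws l) (hN : 𝓛.CodesOntology w N) :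
    Prog.countBelow (seqCode ws) w = l.countP fun M => decide (M ⊆ N) := by
  rw [Prog.countBelow, words_seqCode]
  induction h with
  | nil => rfl
  | cons hv _ ih => simp only [List.countP_cons, ih, hv.forall_mem_words_iff hN]

theorem CodesOntology.exists_subset_select (h : 𝓛.CodesOntology w O) (y : List Bool) :
    ∃ N ⊆ O, 𝓛.CodesOntology (seqCode (select y (words w))) N := by
  classical
  obtain ⟨l, hl, hmem, rfl⟩ := codesOntology_iff.1 h
  rw [words_seqCode]
  obtain ⟨vs, hvs, hy⟩ := exists_sublist_select y (l.map 𝓛.axiomCode.encode)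
  obtain ⟨l', hl', rfl⟩ := List.sublist_map_iff.1 hvs
  refine ⟨l'.toFinset, fun a ha => (hmem a).1 (hl'.subset (List.mem_toFinset.1 ha)),
    codesOntology_iff.2 ⟨l'.reverse, List.nodup_reverse.2 (hl.sublist hl'), by simp, ?_⟩⟩
  rw [hy, List.map_reverse]

theorem CodesOntology.exists_select (h : 𝓛.CodesOntology w O) (hN : N ⊆ O) :
    ∃ y : List Bool, y.length = w.length ∧
      𝓛.CodesOntology (seqCode (select y (words w))) N := by
  classical
  obtain ⟨l, hl, hmem, rfl⟩ := codesOntology_iff.1 h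
  rw [words_seqCode]
  obtain ⟨y, hy, hsel⟩ := exists_select_eq_reverse
    ((List.filter_sublist (p := fun a => decide (a ∈ N)) (l := l)).map 𝓛.axiomCode.encode)
    (length_le_length_seqCode (l.map 𝓛.axiomCode.encode))
  refine ⟨y, hy, codesOntology_iff.2 ⟨(l.filter fun a => decide (a ∈ N)).reverse,
    List.nodup_reverse.2 (hl.filter _), fun a => ?_, ?_⟩⟩
  · simpa [hmem] using fun ha => hN ha
  · rw [hsel, List.map_reverse]

theorem allJust_inClass {C : Set (Set (List Bool))} (hC : PSPACEWithOracle C ⊆ C)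
    (h : 𝓛.entailment.InClass C) : 𝓛.allJust.InClass C := by
  classical
  obtain ⟨A, hA, hAcorrect⟩ := h
  refine ⟨Prog.accepted A, Prog.accepted_mem hC hA, ?_⟩
  rintro _ ⟨O, c, Ms, hO, hMs⟩ ⟨wMs, wO, ⟨l, ws, hl, hmem, hws, rfl⟩, hwO, rfl⟩
  replace hAcorrect : ∀ N ∈ 𝓛.ontologies, ∀ w, 𝓛.CodesOntology w N →
      (seqCode [w, 𝓛.consequenceCode.encode c] ∈ A ↔ 𝓛.Entails N c) :=
    fun N hN w hw => hAcorrect _ ⟨N, c, hN⟩ ⟨w, hw, rfl⟩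
  have hcode : seqCode [seqCode ws, wO, 𝓛.consequenceCode.encode c] = delimit (seqCode ws) ++
      (delimit wO ++ (delimit (𝓛.consequenceCode.encode c) ++ [])) := by simp [seqCode]
  have hagrees : ∀ y N, N ⊆ O → 𝓛.CodesOntology (seqCode (select y (words wO))) N →
      (Prog.agrees A (seqCode ws) wO (𝓛.consequenceCode.encode c) y ↔
        (𝓛.Entails N c ↔ ∃ M ∈ Ms, M ⊆ N)) := by
    intro y N hN hy
    rw [Prog.agrees, hAcorrect N (𝓛.subset_mem N O hN hO) _ hy, countBelow_eq hws hy,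
      List.countP_pos_iff]
    simp [hmem]
  -- The listing has no repetitions, so a count of one leaves no room for a different listed set
  -- below.
  have hone : (∀ u ∈ ws, Prog.countBelow (seqCode ws) u = 1) ↔
      ∀ M ∈ Ms, ∀ N ∈ Ms, N ⊆ M → N = M := by
    have : ∀ u M, 𝓛.CodesOntology u M → M ∈ l → (Prog.countBelow (seqCode ws) u = 1 ↔
        ∀ N ∈ Ms, N ⊆ M → N = M) := by
      intro u M hu hM
      rw [countBelow_eq hws hu, hl.countP_eq_one_iff hM (by simp)]
      simp [hmem]
    constructor
    · intro h M hM
      obtain ⟨u, hu, hu'⟩ := (List.Forall₂.flip (R := fun M u => 𝓛.CodesOntology u M) hws).exists_of_mem ((hmem M).2 hM)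
      exact (this u M hu' ((hmem M).2 hM)).1 (h u hu)
    · intro h u hu
      obtain ⟨M, hM, hM'⟩ := hws.exists_of_mem hu
      exact (this u M hM' hM).2 (h M ((hmem M).1 hM))
  change _ ↔ ∀ M, M ∈ Ms ↔ 𝓛.IsJustification O c M
  rw [forall_mem_iff_isJustification_iff hO hMs, ← hone, hcode, Prog.accepted, Set.mem_ofPred_eq]
  simp only [unword_delimit_append, words_seqCode]
  -- Every subset of `O` is marked by some vector of the right length, and every vector marks a
  -- subset.
  refine and_congr_right fun _ => ⟨fun h N hN => ?_, fun h y _ => ?_⟩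
  · obtain ⟨y, hy, hyN⟩ := hwO.exists_select hN
    exact (hagrees y N hN hyN).1 (h y hy)
  · obtain ⟨N, hN, hyN⟩ := hwO.exists_subset_select y
    exact (hagrees y N hN hyN).2 (h N hN)

theorem allJust_hardFor {C : Set (Set (List Bool))} (hC : PSPACEWithOracle C ⊆ C)
    (h : 𝓛.entailment.HardFor C) : 𝓛.allJust.HardFor C := by
  intro L hL
  obtain ⟨f, hf, hred⟩ := h Lᶜ (compl_mem_of_PSPACEWithOracle_subset hC hL)
  -- The empty set is coded by the empty word, whose delimited form is `[false]`; putting this bit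
  -- in front turns a code of `(O, c)` into one of `(∅, O, c)`.
  refine ⟨fun x => false :: f x, hf.cons false, fun x => ?_⟩
  obtain ⟨⟨O, c, hO⟩, ⟨wO, hwO, hx⟩, hyes⟩ := hred x
  refine ⟨⟨O, c, ∅, hO, by simp⟩, ⟨[], wO, ⟨[], [], by simp, by simp, .nil, rfl⟩, hwO, ?_⟩, ?_⟩
  · simp only [hx]
    simp [seqCode, delimit]
  · change _ ↔ ∀ M, M ∈ (∅ : Finset (Finset 𝒜)) ↔ 𝓛.IsJustification O c M
    simp only [Finset.notMem_empty, false_iff]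
    rw [forall_not_isJustification_iff hO, ← not_iff_not, not_not, ← Set.mem_compl_iff]
    exact hyes

end OntologyLanguage

theorem proposition2 :
    (∀ {𝒜 𝒞 : Type*} (𝓛 : OntologyLanguage 𝒜 𝒞) (C : Set (Set (List Bool))),
      PSPACEWithOracle C ⊆ C →
      𝓛.entailment.CompleteFor C →
      𝓛.allJust.CompleteFor C) ∧
    (∀ k : ℕ, PSPACEWithOracle (EXPSPACE k) ⊆ EXPSPACE k) ∧
    (∀ k : ℕ, PSPACEWithOracle (EXPTIME (k + 1)) ⊆ EXPTIME (k + 1)) :=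
  ⟨fun _ _ hC h => ⟨OntologyLanguage.allJust_inClass hC h.1,
    OntologyLanguage.allJust_hardFor hC h.2⟩, PSPACEWithOracle_EXPSPACE_subset,
    PSPACEWithOracle_EXPTIME_subset⟩
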